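/- **Distributed Borkar–Meyn Theorem.** Let $\mathbb{R}^d=\mathbb{R}^{d_1}\times\dots\times\mathbb{R}^{d_D}$ with the Euclidean norm, let $(\Omega,\mathcal{F},\mathbb{P})$ be a probability space, and let $x_0,x_1$ be random vectors in $\mathbb{R}^d$ with $\mathbb{E}\|x_0\|^2<\infty$ and $\mathbb{E}\|x_1\|^2<\infty$ (for example $x_0=x_1$). Let $x_n=(x_n^1,\dots,x_n^D)$ satisfy the distributed stochastic approximation iteration $$x^i_{n+1}=x^i_n+a(n)\Big[h^i\big(x^1_{n-\tau_{i1}(n)},\dots,x^D_{n-\tau_{iD}(n)}\big)+M^i_{n+1}\Big],\qquad n\ge 1,\ 1\le i\le D,$$ where $h^i$ and $M^i_{n+1}$ denote the $i$-th components, with values in $\mathbb{R}^{d_i}$, of $h:\mathbb{R}^d\to\mathbb{R}^d$ and of the random vector $M_{n+1}$ in $\mathbb{R}^d$. Assume the following. 1. $h$ is Lipschitz continuous. 2. The functions $h_c(x)=h(cx)/c$, $c\ge1$, converge pointwise as $c\to\infty$ to a continuous function $h_\infty$, and the ODE $\dot x(t)=h_\infty(x(t))$ has the origin as its unique globally asymptotically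 stable equilibrium: $h_\infty(0)=0$, the origin is Lyapunov stable, and every solution on $[0,\infty)$ converges to it. 3. Let $\mathcal{F}_1=\sigma(x_0,x_1)$ and, for $n\ge2$, $\mathcal{F}_n=\sigma\big(x_0,x_1,M_2,\dots,M_n,\ \tau_{ij}(1),\dots,\tau_{ij}(n),\ 1\le i,j\le D\big)$. The $M_{n+1}$, $n\ge1$, are integrable, and there is $K>0$ such that for all $n\ge1$ and $1\le i\le D$, almost surely, $\mathbb{E}[M^i_{n+1}\mid\mathcal{F}_n]=0$ and $$\mathbb{E}\big[\|M^i_{n+1}\|^2\mid\mathcal{F}_n\big]\le K^2\Big(1+\big\|\big(x^1_{n-\tau_{i1}(n)},\dots,x^D_{n-\tau_{iD}(n)}\big)\big\|^2\Big).$$ 4. Each $\tau_{ij}$ is an Age of Information Process: for $n\ge 1$, $\tau_{ij}(n)=n-m_{ij}(n)$ for random variables $m_{ij}(n)\in\{0,\dots,n\}$ with $m_{ij}(n)\le m_{ij}(n+1)$; equivalently, $\tau_{ij}(n)$ are random variables in $\{0,\dots,n\}$ with $\tau_{ij}(n+1)\le\tau_{ij}(n)+1$. There are $p>0$ and a non-negative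 random variable $\overline\tau$ (possibly on another probability space) with $\mathbb{E}[\overline\tau^{\,p}]<\infty$ that stochastically dominates every $\tau_{ij}(n)$, that is, $\Pr(\tau_{ij}(n)>r)\le\Pr(\overline\tau>r)$ for all real $r\ge0$, all $n\ge1$ and all $1\le i,j\le D$. 5. For some constant $\alpha>0$: if $p\in(0,1]$, then $a(n)=\alpha/n$ for all $n\ge1$; if $p>1$, then $a(n)=\alpha\,n^{-1/q}$ for all $n\ge1$, for some $q$ with $1<q<\min\{2,p\}$. Then $\sup_n\|x_n\|<\infty$ almost surely. -/

import Mathlib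

open MeasureTheory ProbabilityTheory Filter Topology Set
open scoped NNReal ENNReal

/-- The joint state space `ℝ^d = ℝ^{d_1} × ⋯ × ℝ^{d_D}` with its Euclidean norm;
`x i` is the block of agent `i`. -/
abbrev JointState {D : ℕ} (d : Fin D → ℕ) : Type :=
  PiLp 2 (fun i : Fin D => EuclideanSpace ℝ (Fin (d i)))

/-- The origin is a globally asymptotically stable equilibrium of the autonomous ODE
`ẋ(t) = f (x(t))`, `t ≥ 0`: it is an equilibrium, it is Lyapunov stable, and every solution
converges to it. (It is then the only equilibrium, since constant solutions converge to it.) -/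
structure OriginGloballyAsymptoticallyStable {E : Type*} [NormedAddCommGroup E]
    [NormedSpace ℝ E] (f : E → E) : Prop where
  equilibrium : f 0 = 0
  stable : ∀ ε : ℝ, 0 < ε → ∃ δ : ℝ, 0 < δ ∧
    ∀ y : ℝ → E, IsIntegralCurveOn y (fun _ => f) (Ici 0) → ‖y 0‖ < δ →
      ∀ t : ℝ, 0 ≤ t → ‖y t‖ < ε
  attractive : ∀ y : ℝ → E, IsIntegralCurveOn y (fun _ => f) (Ici 0) →
    Tendsto y atTop (𝓝 0)

/-- The rescaled drifts `h_c(x) = h(c x)/c` converge pointwise, as `c → ∞`, to a continuous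
function whose ODE has the origin as its globally asymptotically stable equilibrium. -/
def HasStableScalingLimit {E : Type*} [NormedAddCommGroup E] [NormedSpace ℝ E]
    (h : E → E) : Prop :=
  ∃ hInf : E → E, Continuous hInf ∧
    (∀ x : E, Tendsto (fun c : ℝ => c⁻¹ • h (c • x)) atTop (𝓝 (hInf x))) ∧
    OriginGloballyAsymptoticallyStable hInf

/-- Age of Information Process: at every time `n ≥ 1` the monitor holds samples of the stream up
to a (random) time `m n ≤ n`; the time stamp `m n` of the newest available sample never decreases,
and the age is `τ n = n - m n`. Equivalently, `τ n ≤ n` and `τ (n + 1) ≤ τ n + 1`. -/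
def IsAoIP {Ω : Type*} [MeasurableSpace Ω] (τ : ℕ → Ω → ℕ) : Prop :=
  ∃ m : ℕ → Ω → ℕ, (∀ n, 1 ≤ n → Measurable (m n)) ∧
    ∀ n, 1 ≤ n → ∀ ω, m n ω ≤ n ∧ m n ω ≤ m (n + 1) ω ∧ τ n ω = n - m n ω

/-- Stochastic dominance `X ≤_st Y` of non-negative random variables, which may live on different
probability spaces: `P'(Y > r) ≥ P(X > r)` for all `r ≥ 0`. -/
def StochDominatedBy {Ω Ω' : Type*} [MeasurableSpace Ω] [MeasurableSpace Ω']
    (P : Measure Ω) (P' : Measure Ω') (X : Ω → ℝ) (Y : Ω' → ℝ) : Prop :=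
  ∀ r : ℝ, 0 ≤ r → P {ω | r < X ω} ≤ P' {ω | r < Y ω}

/-- The stepsize rule for the moment exponent `p`: `a n = α / n` if `p ≤ 1`, and
`a n = α n^{-1/q}` with `1 < q < min {2, p}` if `p > 1`, for some `α > 0`. -/
def IsStepsizeFor (p : ℝ) (a : ℕ → ℝ) : Prop :=
  ∃ α : ℝ, 0 < α ∧
    (p ≤ 1 → ∀ n : ℕ, 1 ≤ n → a n = α / n) ∧
    (1 < p → ∃ q : ℝ, 1 < q ∧ q < min 2 p ∧ ∀ n : ℕ, 1 ≤ n → a n = α * (n : ℝ) ^ (-(1 / q)))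

section Iteration

variable {Ω : Type*} {D : ℕ} {d : Fin D → ℕ}

/-- The aged state `(x^1_{n-τ_{i1}(n)}, …, x^D_{n-τ_{iD}(n)})` that agent `i` uses at time `n`. -/
def agedState (x : ℕ → Ω → JointState d) (τ : Fin D → Fin D → ℕ → Ω → ℕ)
    (i : Fin D) (n : ℕ) (ω : Ω) : JointState d :=
  WithLp.toLp 2 (fun j => x (n - τ i j n ω) ω j)

/-- The distributed stochastic approximation iteration, for all `n ≥ 1` and all agents `i`. -/
def IsDistributedSA (h : JointState d → JointState d) (a : ℕ → ℝ)
    (τ : Fin D → Fin D → ℕ → Ω → ℕ) (M x : ℕ → Ω → JointState d) : Prop :=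
  ∀ n, 1 ≤ n → ∀ i ω,
    x (n + 1) ω i = x n ω i + a n • (h (agedState x τ i n ω) i + M (n + 1) ω i)

/-- The σ-algebras `F_1 = σ(x_0, x_1)` and, for `n ≥ 2`,
`F_n = σ(x_0, x_1, M_2, …, M_n, τ_{ij}(1), …, τ_{ij}(n), 1 ≤ i, j ≤ D)`. -/
@[reducible] def historySigma (τ : Fin D → Fin D → ℕ → Ω → ℕ) (M x : ℕ → Ω → JointState d) (n : ℕ) :
    MeasurableSpace Ω :=
  MeasurableSpace.comap (x 0) inferInstance ⊔ MeasurableSpace.comap (x 1) inferInstance ⊔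
    (⨆ k ∈ Icc 2 n, MeasurableSpace.comap (M k) inferInstance) ⊔
    (⨆ (_ : 2 ≤ n) (i : Fin D) (j : Fin D) (k ∈ Icc 1 n),
      MeasurableSpace.comap (τ i j k) inferInstance)

/-- The noise `M_2, M_3, …` is a martingale difference sequence with respect to the history
σ-algebras, and for some `K > 0` the conditional second moment of `M^i_{n+1}` is at most
`K² (1 + ‖aged state of agent i‖²)`. The second moment is a conditional expectation of a
`[0, ∞]`-valued variable, so that its finiteness is not presupposed. -/
structure IsMartingaleDifferenceNoise [MeasurableSpace Ω] (P : Measure Ω)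
    (τ : Fin D → Fin D → ℕ → Ω → ℕ) (M x : ℕ → Ω → JointState d) : Prop where
  measurable : ∀ n, 1 ≤ n → Measurable (M (n + 1))
  integrable : ∀ n, 1 ≤ n → ∀ i, Integrable (fun ω => M (n + 1) ω i) P
  condExp_eq_zero : ∀ n, 1 ≤ n → ∀ i,
    P[fun ω => M (n + 1) ω i | historySigma τ M x n] =ᵐ[P] 0
  secondMoment_le : ∃ K : ℝ, 0 < K ∧ ∀ n, 1 ≤ n → ∀ i,
    ∀ᵐ ω ∂P, P⁻[fun ω' => ENNReal.ofReal (‖M (n + 1) ω' i‖ ^ 2) | historySigma τ M x n] ω ≤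
      ENNReal.ofReal (K ^ 2 * (1 + ‖agedState x τ i n ω‖ ^ 2))

end Iteration

/-! Let R n be the maximum of 1 and of the norms of the iterates up to time n. Everything is
measured relative to R n, which makes noise and delays harmless before boundedness is known.

Noise: an aged state has norm at most √D * R n, so the noise divided by R n has bounded second
moments. Its partial sums N, weighted by the square-summable stepsizes, form an L² martingale in
each coordinate and converge almost surely (`ae_cauchySeq_normalized`). As R is monotone, summation
by parts shows that the true noise accumulated between n and m is at most 2 * R m times a small
oscillation of N (`norm_sum_smul_sub_le`).

Delays: Borel–Cantelli makes every age o(n ^ β), where β is the stepsize exponent, so a delay spans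
vanishing ODE time (`ae_tendsto_div_rpow`, `eventually_sum_lag_le`). Over such a window the iterate
moves by o(R n), and the delayed drift is h (x n) + o(R n).

Stability: by Gronwall, R grows by a bounded factor over bounded ODE time. Once R n is large, the
iterates after time n divided by R n therefore track the ODE of the scaling limit
(`exists_tracking`). Starting in the unit ball, that ODE is inside a small δ-ball after a uniform
time T; restarted from the δ-ball it stays below 1/2 by Lyapunov stability. Hence from some time on
each window begins and ends below δ * R and never exceeds R in between, so R is frozen
(`IsNormalizedScheme.bddAbove_norm`). -/

/-! ### Flows of globally Lipschitz vector fields and uniform attraction. -/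

section ODE

variable {E : Type*} [NormedAddCommGroup E] [NormedSpace ℝ E]

/-- An integral curve on `[0, b]` of a Lipschitz vector field can be prolonged by a time
`(K + 1)⁻¹` that does not depend on its end point. -/
theorem exists_integralCurve_Icc_extend [CompleteSpace E] {f : E → E} {K : ℝ≥0}
    (hf : LipschitzWith K f) {b : ℝ} (hb : 0 ≤ b) {y : ℝ → E}
    (hy : IsIntegralCurveOn y (fun _ => f) (Icc 0 b)) :
    ∃ z : ℝ → E, z 0 = y 0 ∧
      IsIntegralCurveOn z (fun _ => f) (Icc 0 (b + ((K : ℝ) + 1)⁻¹)) := by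
  set ε : ℝ := ((K : ℝ) + 1)⁻¹ with hε
  have hεpos : 0 < ε := by positivity
  have hmem : b ∈ Icc b (b + ε) := ⟨le_rfl, by linarith⟩
  -- On the ball of radius ‖f (y b)‖ the speed is at most (K + 1) * ‖f (y b)‖, so the exit time is
  -- at least (K + 1)⁻¹ wherever the curve ends.
  have hPL : IsPicardLindelof (fun _ : ℝ => f) (⟨b, hmem⟩ : Icc b (b + ε)) (y b) ‖f (y b)‖₊ 0
      ((K + 1) * ‖f (y b)‖₊) K := by
    apply IsPicardLindelof.of_time_independent
    · intro u hu
      have h1 : ‖f u - f (y b)‖ ≤ K * ‖u - y b‖ := by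
        simpa [dist_eq_norm] using hf.dist_le_mul u (y b)
      have h2 : ‖u - y b‖ ≤ ‖f (y b)‖ := by simpa [dist_eq_norm] using hu
      have h3 : ‖f u‖ ≤ ‖f u - f (y b)‖ + ‖f (y b)‖ := by
        simpa using norm_add_le (f u - f (y b)) (f (y b))
      have h4 : (K : ℝ) * ‖u - y b‖ ≤ K * ‖f (y b)‖ := by gcongr
      push_cast
      linarith
    · exact hf.lipschitzOnWith
    · have : max (b + ε - b) (b - b) = ε := by
        rw [sub_self, add_sub_cancel_left, max_eq_left hεpos.le]
      simp only [this]
      push_cast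
      rw [hε, sub_zero, mul_comm ((K : ℝ) + 1), mul_assoc, mul_inv_cancel₀ (by positivity), mul_one]
  obtain ⟨z, hz0, hz⟩ := hPL.exists_eq_forall_mem_Icc_hasDerivWithinAt₀
  simp only at hz0
  set w : ℝ → E := fun t => if t ≤ b then y t else z t with hw
  have hwl : EqOn w y (Icc 0 b) := fun t ht => by simp [hw, ht.2]
  have hwr : EqOn w z (Icc b (b + ε)) := fun t ht => by
    rcases eq_or_lt_of_le ht.1 with h | h
    · subst h; simp [hw, hz0]
    · simp [hw, not_le.mpr h]
  refine ⟨w, hwl ⟨le_rfl, hb⟩, fun t ht => ?_⟩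
  have hun : Icc (0 : ℝ) (b + ε) = Icc 0 b ∪ Icc b (b + ε) :=
    (Icc_union_Icc_eq_Icc hb (by linarith)).symm
  rw [hun]
  refine HasDerivWithinAt.union ?_ ?_
  · rcases le_or_gt t b with h | h
    · have := (hy t ⟨ht.1, h⟩).congr_of_mem hwl ⟨ht.1, h⟩
      simpa only [hwl ⟨ht.1, h⟩] using this
    -- Away from the closure of a piece, any value is a derivative within it, so only the piece
    -- containing t matters.
    · refine HasFDerivWithinAt.of_notMem_closure ?_
      rw [isClosed_Icc.closure_eq]
      exact fun h' => absurd h'.2 (not_le.mpr h)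
  · rcases le_or_gt b t with h | h
    · have := (hz t ⟨h, ht.2⟩).congr_of_mem hwr ⟨h, ht.2⟩
      simpa only [hwr ⟨h, ht.2⟩] using this
    · refine HasFDerivWithinAt.of_notMem_closure ?_
      rw [isClosed_Icc.closure_eq]
      exact fun h' => absurd h'.1 (not_le.mpr h)

theorem IsIntegralCurveOn.hasDerivWithinAt_Ici_of_Icc {f : E → E} {y : ℝ → E} {b t : ℝ}
    (hy : IsIntegralCurveOn y (fun _ => f) (Icc 0 b)) (ht : t ∈ Ico 0 b) :
    HasDerivWithinAt y (f (y t)) (Ici t) t :=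
  ((hy t ⟨ht.1, ht.2.le⟩).mono (Icc_subset_Icc_left ht.1)).mono_of_mem_nhdsWithin
    (Icc_mem_nhdsGE ht.2)

theorem dist_integralCurve_le {f : E → E} {K : ℝ≥0} (hf : LipschitzWith K f) {y z : ℝ → E} {b : ℝ}
    (hy : IsIntegralCurveOn y (fun _ => f) (Icc 0 b))
    (hz : IsIntegralCurveOn z (fun _ => f) (Icc 0 b)) :
    ∀ t ∈ Icc 0 b, dist (y t) (z t) ≤ dist (y 0) (z 0) * Real.exp (K * t) := by
  intro t ht
  simpa using dist_le_of_trajectories_ODE (v := fun _ => f) (fun _ => hf) hy.continuousOn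
    (fun t ht => hy.hasDerivWithinAt_Ici_of_Icc ht) hz.continuousOn
    (fun t ht => hz.hasDerivWithinAt_Ici_of_Icc ht) le_rfl t ht

/-- A globally Lipschitz vector field has integral curves defined for all positive times. -/
theorem exists_integralCurve_Ici [CompleteSpace E] {f : E → E} {K : ℝ≥0}
    (hf : LipschitzWith K f) (x₀ : E) :
    ∃ y : ℝ → E, y 0 = x₀ ∧ IsIntegralCurveOn y (fun _ => f) (Ici 0) := by
  set ε : ℝ := ((K : ℝ) + 1)⁻¹ with hε
  have hεpos : 0 < ε := by positivity
  have step : ∀ n : ℕ, ∃ y : ℝ → E, y 0 = x₀ ∧ IsIntegralCurveOn y (fun _ => f) (Icc 0 (n * ε)) := by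
    intro n
    induction n with
    | zero =>
      refine ⟨fun _ => x₀, rfl, fun t ht => ?_⟩
      have : Icc (0 : ℝ) ((0 : ℕ) * ε) = {0} := by simp
      rw [this] at ht ⊢
      rw [mem_singleton_iff.mp ht]
      exact HasFDerivWithinAt.of_subsingleton subsingleton_singleton
    | succ n ih =>
      obtain ⟨y, hy0, hy⟩ := ih
      obtain ⟨z, hz0, hz⟩ := exists_integralCurve_Icc_extend hf (by positivity) hy
      refine ⟨z, hz0.trans hy0, ?_⟩
      have : ((n + 1 : ℕ) : ℝ) * ε = n * ε + ε := by push_cast; ring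
      rwa [this]
  choose Y hY0 hY using step
  have agree : ∀ m n : ℕ, ∀ t, 0 ≤ t → t ≤ m * ε → t ≤ n * ε → Y m t = Y n t := by
    intro m n t h0 hm hn
    have := dist_integralCurve_le hf (b := t) ((hY m).mono (Icc_subset_Icc_right hm))
      ((hY n).mono (Icc_subset_Icc_right hn)) t ⟨h0, le_rfl⟩
    rw [hY0, hY0, dist_self, zero_mul] at this
    exact dist_le_zero.mp this
  have hN : ∀ t : ℝ, t ≤ (⌈t / ε⌉₊ : ℝ) * ε := fun t => by
    rw [← div_le_iff₀ hεpos]; exact Nat.le_ceil _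
  refine ⟨fun t => Y ⌈t / ε⌉₊ t, hY0 _, fun t ht => ?_⟩
  have ht0 : (0 : ℝ) ≤ t := ht
  -- The extra 1 puts t strictly before the end of the interval, so that interval is a neighbourhood
  -- of t within `Ici 0`.
  set n := ⌈t / ε⌉₊ + 1 with hn
  have htn : t < n * ε := by
    have := hN t
    rw [hn]; push_cast; linarith
  have hEq : EqOn (fun t => Y ⌈t / ε⌉₊ t) (Y n) (Icc 0 (n * ε)) :=
    fun u hu => agree _ _ u hu.1 (hN u) hu.2
  have h1 : HasDerivWithinAt (Y n) (f (Y n t)) (Ici 0) t := by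
    refine (hY n t ⟨ht0, htn.le⟩).mono_of_mem_nhdsWithin ?_
    rw [← Ici_inter_Iic]
    exact inter_mem self_mem_nhdsWithin (mem_nhdsWithin_of_mem_nhds (Iic_mem_nhds htn))
  have hmem : Icc 0 (n * ε) ∈ 𝓝[Ici 0] t := by
    rw [← Ici_inter_Iic]
    exact inter_mem self_mem_nhdsWithin (mem_nhdsWithin_of_mem_nhds (Iic_mem_nhds htn))
  have h2 := h1.congr_of_eventuallyEq (f₁ := fun t => Y ⌈t / ε⌉₊ t)
    (Filter.mem_of_superset hmem hEq) (hEq ⟨ht0, htn.le⟩)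
  simpa only [← hEq ⟨ht0, htn.le⟩] using h2

theorem IsIntegralCurveOn.comp_add_Ici {f : E → E} {y : ℝ → E}
    (hy : IsIntegralCurveOn y (fun _ => f) (Ici 0)) {s : ℝ} (hs : 0 ≤ s) :
    IsIntegralCurveOn (fun t => y (t + s)) (fun _ => f) (Ici 0) := by
  intro t ht
  have ht0 : (0 : ℝ) ≤ t := ht
  have h1 := hy (t + s) (add_nonneg ht0 hs)
  have h2 : HasDerivWithinAt (fun t : ℝ => t + s) 1 (Ici 0) t :=
    ((hasDerivAt_id t).add_const s).hasDerivWithinAt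
  simpa [Function.comp_def] using h1.scomp t h2 (fun u hu => add_nonneg (mem_Ici.mp hu) hs)

/-- Attraction to an asymptotically stable equilibrium of a Lipschitz vector field is uniform
over balls of initial values. -/
theorem OriginGloballyAsymptoticallyStable.uniform_attractive [ProperSpace E] {f : E → E} {K : ℝ≥0}
    (hf : LipschitzWith K f) (hs : OriginGloballyAsymptoticallyStable f) (r : ℝ) {ε : ℝ}
    (hε : 0 < ε) :
    ∃ T : ℝ, 0 < T ∧ ∀ y : ℝ → E, IsIntegralCurveOn y (fun _ => f) (Ici 0) → ‖y 0‖ ≤ r →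
      ∀ t, T ≤ t → ‖y t‖ < ε := by
  obtain ⟨δ, hδ, hstab⟩ := hs.stable ε hε
  choose Y hY0 hY using exists_integralCurve_Ici hf
  have htime : ∀ x : E, ∃ T : ℝ, 0 < T ∧ ‖Y x T‖ < δ / 2 := by
    intro x
    have h1 := (hs.attractive (Y x) (hY x)).norm
    rw [norm_zero] at h1
    obtain ⟨T, hT1, hT2⟩ := ((h1.eventually_lt_const (half_pos hδ)).and
      (eventually_gt_atTop 0)).exists
    exact ⟨T, hT2, hT1⟩
  choose T hT0 hT using htime
  -- Solutions starting near x are still within δ / 2 of the one from x at time T x, hence inside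
  -- the δ-ball, and stability confines them from then on. Compactness leaves finitely many x.
  have hcover : ∀ x : E, ∃ ρ > 0, ∀ y : ℝ → E, IsIntegralCurveOn y (fun _ => f) (Ici 0) →
      y 0 ∈ Metric.ball x ρ → ∀ t, T x ≤ t → ‖y t‖ < ε := by
    intro x
    refine ⟨δ / 2 / Real.exp (K * T x), by positivity, fun y hy hyx t ht => ?_⟩
    have h1 := dist_integralCurve_le hf (hy.mono (fun u hu => hu.1 : Icc 0 (T x) ⊆ Ici 0))
      ((hY x).mono Icc_subset_Ici_self) (T x) ⟨(hT0 x).le, le_rfl⟩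
    rw [hY0] at h1
    have h2 : dist (y 0) x * Real.exp (K * T x) < δ / 2 :=
      (lt_div_iff₀ (Real.exp_pos _)).mp (Metric.mem_ball.mp hyx)
    have h3 : ‖y (T x)‖ ≤ dist (y (T x)) (Y x (T x)) + ‖Y x (T x)‖ := by
      rw [dist_eq_norm]; simpa using norm_add_le (y (T x) - Y x (T x)) (Y x (T x))
    have h4 : ‖y (T x)‖ < δ := by linarith [hT x]
    have := hstab _ (hy.comp_add_Ici (hT0 x).le) (by simpa using h4) (t - T x) (by linarith)
    simpa using this
  choose ρ hρ0 hρ using hcover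
  obtain ⟨s, -, hs'⟩ := (isCompact_closedBall (0 : E) r).elim_nhds_subcover
    (fun x => Metric.ball x (ρ x)) (fun x _ => Metric.ball_mem_nhds x (hρ0 x))
  -- The sum dominates each T x; the 1 keeps the time positive even for an empty cover.
  refine ⟨1 + ∑ x ∈ s, T x, by
    have := Finset.sum_nonneg (fun x (_ : x ∈ s) => (hT0 x).le); linarith, fun y hy hyr t ht => ?_⟩
  have hmem : y 0 ∈ Metric.closedBall (0 : E) r := by simpa using hyr
  obtain ⟨x, hx, hyx⟩ := mem_iUnion₂.mp (hs' hmem)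
  have := Finset.single_le_sum (fun x (_ : x ∈ s) => (hT0 x).le) hx
  exact hρ x y hy hyx t (by linarith)

theorem norm_integralCurve_le {f : E → E} {K : ℝ≥0} (hf : LipschitzWith K f) (h0 : f 0 = 0)
    {y : ℝ → E} (hy : IsIntegralCurveOn y (fun _ => f) (Ici 0)) {t : ℝ} (ht : 0 ≤ t) :
    ‖y t‖ ≤ ‖y 0‖ * Real.exp (K * t) := by
  have hz : IsIntegralCurveOn (fun _ : ℝ => (0 : E)) (fun _ => f) (Icc 0 t) := fun s _ => by
    simpa [h0] using hasDerivWithinAt_const s (Icc 0 t) (0 : E)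
  simpa using dist_integralCurve_le hf (hy.mono Icc_subset_Ici_self) hz t ⟨ht, le_rfl⟩

/-- The local error of the Euler scheme. -/
theorem norm_integralCurve_sub_euler_le {f : E → E} {K : ℝ≥0} (hf : LipschitzWith K f)
    {y : ℝ → E} (hy : IsIntegralCurveOn y (fun _ => f) (Ici 0)) {t s C : ℝ} (ht : 0 ≤ t)
    (hs : 0 ≤ s) (hC : ∀ u ∈ Icc t (t + s), ‖f (y u)‖ ≤ C) :
    ‖y (t + s) - y t - s • f (y t)‖ ≤ K * C * s * s := by
  have hsub : Icc t (t + s) ⊆ Ici 0 := fun u hu => ht.trans hu.1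
  have hd : ∀ u ∈ Icc t (t + s), HasDerivWithinAt y (f (y u)) (Icc t (t + s)) u :=
    fun u hu => (hy u (hsub hu)).mono hsub
  have htm : t ∈ Icc t (t + s) := ⟨le_rfl, by linarith⟩
  have htm' : t + s ∈ Icc t (t + s) := ⟨by linarith, le_rfl⟩
  have hC0 : 0 ≤ C := (norm_nonneg _).trans (hC t htm)
  have h1 : ∀ u ∈ Icc t (t + s), ‖y u - y t‖ ≤ C * s := by
    intro u hu
    refine ((convex_Icc t (t + s)).norm_image_sub_le_of_norm_hasDerivWithin_le hd hC htm hu).trans ?_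
    gcongr
    rw [Real.norm_eq_abs, abs_of_nonneg (by linarith [hu.1])]
    linarith [hu.2]
  -- Subtracting the linear motion leaves a derivative of order s, so a second mean value estimate
  -- gives an error of order s².
  have h2 : ∀ u ∈ Icc t (t + s), HasDerivWithinAt (fun u => y u - u • f (y t))
      (f (y u) - f (y t)) (Icc t (t + s)) u := by
    intro u hu
    simpa using (hd u hu).fun_sub ((hasDerivWithinAt_id u _).smul_const (f (y t)))
  have h3 : ∀ u ∈ Icc t (t + s), ‖f (y u) - f (y t)‖ ≤ K * C * s := by
    intro u hu
    have := hf.dist_le_mul (y u) (y t)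
    rw [dist_eq_norm, dist_eq_norm] at this
    refine this.trans ?_
    rw [mul_assoc]
    gcongr
    exact h1 u hu
  have h4 := (convex_Icc t (t + s)).norm_image_sub_le_of_norm_hasDerivWithin_le h2 h3 htm htm'
  have h5 : y (t + s) - (t + s) • f (y t) - (y t - t • f (y t))
      = y (t + s) - y t - s • f (y t) := by rw [add_smul]; abel
  rw [h5] at h4
  simpa [abs_of_nonneg hs] using h4

end ODE

/-! ### Rescaled drifts and their limit. -/

section ScalingLimit

variable {E : Type*} [NormedAddCommGroup E] [NormedSpace ℝ E]

theorem norm_scaled_sub_le {h : E → E} {K : ℝ≥0} (hK : LipschitzWith K h) {c : ℝ} (hc : 0 < c)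
    (x y : E) : ‖c⁻¹ • h (c • x) - c⁻¹ • h (c • y)‖ ≤ K * ‖x - y‖ := by
  have h1 := hK.dist_le_mul (c • x) (c • y)
  rw [dist_eq_norm, dist_eq_norm, ← smul_sub, norm_smul, Real.norm_eq_abs, abs_of_pos hc] at h1
  rw [← smul_sub, norm_smul, norm_inv, Real.norm_eq_abs, abs_of_pos hc]
  calc c⁻¹ * ‖h (c • x) - h (c • y)‖ ≤ c⁻¹ * (K * (c * ‖x - y‖)) := by gcongr
    _ = K * ‖x - y‖ := by field_simp

theorem lipschitzWith_scalingLimit {h hInf : E → E} {K : ℝ≥0} (hK : LipschitzWith K h)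
    (hlim : ∀ x : E, Tendsto (fun c : ℝ => c⁻¹ • h (c • x)) atTop (𝓝 (hInf x))) :
    LipschitzWith K hInf := by
  refine LipschitzWith.of_dist_le_mul fun x y => ?_
  rw [dist_eq_norm, dist_eq_norm]
  refine le_of_tendsto ((hlim x).sub (hlim y)).norm ?_
  filter_upwards [eventually_gt_atTop 0] with c hc
  exact norm_scaled_sub_le hK hc x y

/-- All rescaled drifts share the Lipschitz constant K, so pointwise convergence on a finite net of
a compact ball is already uniform convergence. -/
theorem scalingLimit_uniform_on_ball [ProperSpace E] {h hInf : E → E} {K : ℝ≥0}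
    (hK : LipschitzWith K h)
    (hlim : ∀ x : E, Tendsto (fun c : ℝ => c⁻¹ • h (c • x)) atTop (𝓝 (hInf x)))
    (B : ℝ) {ε : ℝ} (hε : 0 < ε) :
    ∀ᶠ c : ℝ in atTop, ∀ x : E, ‖x‖ ≤ B → ‖c⁻¹ • h (c • x) - hInf x‖ ≤ ε := by
  have hInfK := lipschitzWith_scalingLimit hK hlim
  set ρ : ℝ := ε / (3 * (K + 1)) with hρ
  have hρ0 : 0 < ρ := by positivity
  obtain ⟨s, -, hs⟩ := (isCompact_closedBall (0 : E) B).elim_nhds_subcover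
    (fun x => Metric.ball x ρ) (fun x _ => Metric.ball_mem_nhds x hρ0)
  have hfin : ∀ᶠ c : ℝ in atTop, ∀ z ∈ s, ‖c⁻¹ • h (c • z) - hInf z‖ < ε / 3 := by
    rw [Filter.eventually_all_finset]
    intro z _
    have := ((hlim z).sub_const (hInf z)).norm
    rw [sub_self, norm_zero] at this
    exact this.eventually_lt_const (by positivity)
  filter_upwards [hfin, eventually_gt_atTop 0] with c hc hc0 x hx
  obtain ⟨z, hz, hxz⟩ := mem_iUnion₂.mp (hs (by simpa using hx : x ∈ Metric.closedBall (0 : E) B))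
  have hxz' : (K : ℝ) * ‖x - z‖ ≤ ε / 3 := by
    have h1 : ‖x - z‖ ≤ ρ := by simpa [dist_eq_norm] using (Metric.mem_ball.mp hxz).le
    calc (K : ℝ) * ‖x - z‖ ≤ (K + 1) * ρ := by gcongr; linarith
      _ = ε / 3 := by rw [hρ]; field_simp
  have h1 := norm_scaled_sub_le hK hc0 x z
  have h2 : ‖hInf z - hInf x‖ ≤ K * ‖x - z‖ := by
    have := hInfK.dist_le_mul z x
    rwa [dist_eq_norm, dist_eq_norm, norm_sub_rev z x] at this
  have h3 := hc z hz
  calc ‖c⁻¹ • h (c • x) - hInf x‖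
      = ‖(c⁻¹ • h (c • x) - c⁻¹ • h (c • z)) + (c⁻¹ • h (c • z) - hInf z)
          + (hInf z - hInf x)‖ := by congr 1; abel
    _ ≤ _ := norm_add₃_le
    _ ≤ ε := by linarith

end ScalingLimit

/-! ### The running maximum used for normalization. -/

/-- The running maximum of `1` and `u 0, …, u n`. -/
noncomputable def runningMax (u : ℕ → ℝ) : ℕ → ℝ
  | 0 => max 1 (u 0)
  | n + 1 => max (runningMax u n) (u (n + 1))

section RunningMax

variable {u : ℕ → ℝ}

theorem runningMax_monotone : Monotone (runningMax u) :=
  monotone_nat_of_le_succ fun _ => le_max_left _ _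

theorem one_le_runningMax (n : ℕ) : 1 ≤ runningMax u n :=
  (le_max_left 1 (u 0)).trans (runningMax_monotone (Nat.zero_le n))

theorem runningMax_pos (n : ℕ) : 0 < runningMax u n := one_pos.trans_le (one_le_runningMax n)

theorem le_runningMax_self (n : ℕ) : u n ≤ runningMax u n := by
  cases n <;> exact le_max_right _ _

theorem le_runningMax {k n : ℕ} (hkn : k ≤ n) : u k ≤ runningMax u n :=
  (le_runningMax_self k).trans (runningMax_monotone hkn)

theorem runningMax_le {n m : ℕ} {B : ℝ} (hnm : n ≤ m) (hn : runningMax u n ≤ B)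
    (h : ∀ j, n < j → j ≤ m → u j ≤ B) : runningMax u m ≤ B := by
  induction m, hnm using Nat.le_induction with
  | base => exact hn
  | succ m hm ih =>
    exact max_le (ih fun j h1 h2 => h j h1 (h2.trans m.le_succ)) (h _ (by omega) le_rfl)

end RunningMax

/-! ### Discrete Gronwall inequality and summation by parts. -/

section Gronwall

/-- The right-hand side of the hypothesis gains a factor of at most 1 + b m ≤ exp (b m) per step.
The cap M allows hypotheses that hold only inside a finite window. -/
theorem le_mul_exp_of_le_add_sum {v b : ℕ → ℝ} {A : ℝ} (hA : 0 ≤ A) {n M : ℕ}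
    (hb : ∀ k, n ≤ k → 0 ≤ b k)
    (h : ∀ m, n ≤ m → m ≤ M → v m ≤ A + ∑ k ∈ Finset.Ico n m, b k * v k) {m : ℕ} (hnm : n ≤ m)
    (hmM : m ≤ M) : v m ≤ A * Real.exp (∑ k ∈ Finset.Ico n m, b k) := by
  have key : ∀ m, n ≤ m → m ≤ M →
      A + ∑ k ∈ Finset.Ico n m, b k * v k ≤ A * Real.exp (∑ k ∈ Finset.Ico n m, b k) := by
    intro m hnm
    induction m, hnm using Nat.le_induction with
    | base => simp
    | succ m hm ih =>
      intro hM
      have ih := ih (by omega)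
      have hv := (h m hm (by omega)).trans ih
      rw [Finset.sum_Ico_succ_top hm, Finset.sum_Ico_succ_top hm, Real.exp_add]
      have h1 : b m * v m ≤ b m * (A * Real.exp (∑ k ∈ Finset.Ico n m, b k)) :=
        mul_le_mul_of_nonneg_left hv (hb m hm)
      have h2 := mul_le_mul_of_nonneg_left (Real.add_one_le_exp (b m))
        (mul_nonneg hA (Real.exp_pos (∑ k ∈ Finset.Ico n m, b k)).le)
      linarith
  exact (h m hnm hmM).trans (key m hnm hmM)

end Gronwall

/-- Abel summation: the total variation of monotone weights is R m - R n, so the bound sees only the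
last weight and the oscillation of N, not the number of terms. -/
theorem norm_sum_smul_sub_le {E : Type*} [NormedAddCommGroup E] [NormedSpace ℝ E] {N : ℕ → E}
    {R : ℕ → ℝ} (hR : Monotone R) (hR0 : ∀ k, 0 ≤ R k) {ε : ℝ} {n : ℕ}
    (hN : ∀ k, n ≤ k → ‖N k - N n‖ ≤ ε) {m : ℕ} (hnm : n ≤ m) :
    ‖∑ k ∈ Finset.Ico n m, R k • (N (k + 1) - N k)‖ ≤ 2 * R m * ε := by
  have hε : 0 ≤ ε := (norm_nonneg _).trans (hN n le_rfl)
  have key : ‖∑ k ∈ Finset.Ico n m, R k • (N (k + 1) - N k) - R m • (N m - N n)‖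
      ≤ (R m - R n) * ε := by
    induction m, hnm using Nat.le_induction with
    | base => simp
    | succ m hm ih =>
      rw [Finset.sum_Ico_succ_top hm]
      have h1 : ∑ k ∈ Finset.Ico n m, R k • (N (k + 1) - N k) + R m • (N (m + 1) - N m)
          - R (m + 1) • (N (m + 1) - N n)
          = (∑ k ∈ Finset.Ico n m, R k • (N (k + 1) - N k) - R m • (N m - N n))
            - (R (m + 1) - R m) • (N (m + 1) - N n) := by
        simp only [smul_sub, sub_smul]; abel
      rw [h1]
      refine (norm_sub_le _ _).trans ?_
      have h2 : 0 ≤ R (m + 1) - R m := sub_nonneg.mpr (hR m.le_succ)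
      rw [norm_smul, Real.norm_eq_abs, abs_of_nonneg h2]
      have h3 := mul_le_mul_of_nonneg_left (hN (m + 1) (by omega)) h2
      linarith
  have h4 : ‖R m • (N m - N n)‖ ≤ R m * ε := by
    rw [norm_smul, Real.norm_eq_abs, abs_of_nonneg (hR0 m)]
    exact mul_le_mul_of_nonneg_left (hN m hnm) (hR0 m)
  have h5 := norm_sub_norm_le (∑ k ∈ Finset.Ico n m, R k • (N (k + 1) - N k)) (R m • (N m - N n))
  have h6 := mul_nonneg (hR0 n) hε
  linarith

/-! ### Normalized schemes: growth, ODE tracking and boundedness. -/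

/-- A scheme `x (n+1) = x n + a n • g n + R n • (N (n+1) - N n)`, where `R` is the running maximum
of the norms of the iterates, the drift `g` grows at most like `R`, and the normalized noise has
convergent partial sums `N`. -/
structure IsNormalizedScheme {E : Type*} [NormedAddCommGroup E] [NormedSpace ℝ E]
    (x g N : ℕ → E) (a : ℕ → ℝ) (C : ℝ) : Prop where
  step : ∀ n, 1 ≤ n →
    x (n + 1) = x n + a n • g n + runningMax (fun k => ‖x k‖) n • (N (n + 1) - N n)
  stepsize_nonneg : ∀ n, 1 ≤ n → 0 ≤ a n
  const_nonneg : 0 ≤ C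
  drift_le : ∀ n, 1 ≤ n → ‖g n‖ ≤ C * runningMax (fun k => ‖x k‖) n
  cauchy : CauchySeq N

namespace IsNormalizedScheme

variable {E : Type*} [NormedAddCommGroup E] [NormedSpace ℝ E] {x g N : ℕ → E} {a : ℕ → ℝ} {C : ℝ}

theorem eventually_noise_le (hx : IsNormalizedScheme x g N a C) {ε : ℝ} (hε : 0 < ε) :
    ∀ᶠ n in atTop, ∀ k, n ≤ k → ‖N k - N n‖ ≤ ε := by
  obtain ⟨n₀, h⟩ := Metric.cauchySeq_iff.mp hx.cauchy ε hε
  filter_upwards [eventually_ge_atTop n₀] with n hn k hk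
  rw [← dist_eq_norm]
  exact (h k (hn.trans hk) n hn).le

theorem norm_iterate_sub_le (hx : IsNormalizedScheme x g N a C) {ε : ℝ} {n m : ℕ} (hn : 1 ≤ n)
    (hnm : n ≤ m) (hN : ∀ k, n ≤ k → ‖N k - N n‖ ≤ ε) :
    ‖x m - x n‖ ≤ C * ∑ k ∈ Finset.Ico n m, a k * runningMax (fun k => ‖x k‖) k
      + 2 * runningMax (fun k => ‖x k‖) m * ε := by
  set R := runningMax (fun k => ‖x k‖)
  have hS := norm_sum_smul_sub_le (R := R) runningMax_monotone (fun k => (runningMax_pos k).le)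
    hN hnm
  have key : ‖x m - x n - ∑ k ∈ Finset.Ico n m, R k • (N (k + 1) - N k)‖
      ≤ C * ∑ k ∈ Finset.Ico n m, a k * R k := by
    clear hS
    induction m, hnm using Nat.le_induction with
    | base => simp
    | succ m hm ih =>
      rw [Finset.sum_Ico_succ_top hm, Finset.sum_Ico_succ_top hm, hx.step m (hn.trans hm)]
      have h1 : x m + a m • g m + R m • (N (m + 1) - N m) - x n
          - (∑ k ∈ Finset.Ico n m, R k • (N (k + 1) - N k) + R m • (N (m + 1) - N m))
          = (x m - x n - ∑ k ∈ Finset.Ico n m, R k • (N (k + 1) - N k)) + a m • g m := by abel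
      rw [h1]
      refine (norm_add_le _ _).trans ?_
      have ha := hx.stepsize_nonneg m (hn.trans hm)
      rw [norm_smul, Real.norm_eq_abs, abs_of_nonneg ha]
      have h2 := mul_le_mul_of_nonneg_left (hx.drift_le m (hn.trans hm)) ha
      change a m * ‖g m‖ ≤ a m * (C * R m) at h2
      linarith
  have h3 := norm_sub_norm_le (x m - x n) (∑ k ∈ Finset.Ico n m, R k • (N (k + 1) - N k))
  linarith

/-- This version serves for delay windows, where the sum of the stepsizes is small and the motion is
thus negligible against R. -/
theorem norm_iterate_sub_le_mul_runningMax (hx : IsNormalizedScheme x g N a C) {ε : ℝ} {n m : ℕ}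
    (hn : 1 ≤ n) (hnm : n ≤ m) (hN : ∀ k, n ≤ k → ‖N k - N n‖ ≤ ε) :
    ‖x m - x n‖ ≤ (C * ∑ k ∈ Finset.Ico n m, a k + 2 * ε) * runningMax (fun k => ‖x k‖) m := by
  set R := runningMax (fun k => ‖x k‖)
  have h1 : ∑ k ∈ Finset.Ico n m, a k * R k ≤ (∑ k ∈ Finset.Ico n m, a k) * R m := by
    rw [Finset.sum_mul]
    refine Finset.sum_le_sum fun k hk => ?_
    rw [Finset.mem_Ico] at hk
    exact mul_le_mul_of_nonneg_left (runningMax_monotone hk.2.le)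
      (hx.stepsize_nonneg k (hn.trans hk.1))
  have h2 := hx.norm_iterate_sub_le hn hnm hN
  have h3 := mul_le_mul_of_nonneg_left h1 hx.const_nonneg
  change ‖x m - x n‖ ≤ C * ∑ k ∈ Finset.Ico n m, a k * R k + 2 * R m * ε at h2
  linarith

/-- With noise oscillation 1 / 4 the noise contributes at most R m / 2, which is absorbed on the
left at the price of a factor 2; Gronwall does the rest. -/
theorem runningMax_le_mul_exp (hx : IsNormalizedScheme x g N a C) {n m : ℕ} (hn : 1 ≤ n)
    (hnm : n ≤ m) (hN : ∀ k, n ≤ k → ‖N k - N n‖ ≤ 1 / 4) :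
    runningMax (fun k => ‖x k‖) m ≤
      2 * runningMax (fun k => ‖x k‖) n * Real.exp (2 * C * ∑ k ∈ Finset.Ico n m, a k) := by
  set R := runningMax (fun k => ‖x k‖) with hR
  have hR0 : ∀ k, 0 ≤ R k := fun k => (runningMax_pos k).le
  have hterm : ∀ k, n ≤ k → 0 ≤ a k * R k := fun k hk =>
    mul_nonneg (hx.stepsize_nonneg k (hn.trans hk)) (hR0 k)
  have key : ∀ m, n ≤ m → m ≤ m → R m ≤ 2 * R n + ∑ k ∈ Finset.Ico n m, (2 * C * a k) * R k := by
    intro m hm _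
    have h1 : R m ≤ R n + C * ∑ k ∈ Finset.Ico n m, a k * R k + R m / 2 := by
      have hsum0 : 0 ≤ C * ∑ k ∈ Finset.Ico n m, a k * R k :=
        mul_nonneg hx.const_nonneg
          (Finset.sum_nonneg fun k hk => hterm k (Finset.mem_Ico.mp hk).1)
      refine runningMax_le hm (by have := hR0 m; linarith) fun j hj1 hj2 => ?_
      have h2 := hx.norm_iterate_sub_le hn hj1.le hN
      have h3 : ‖x n‖ ≤ R n := le_runningMax_self (u := fun k => ‖x k‖) n
      have h4 := norm_sub_norm_le (x j) (x n)
      have h5 : ∑ k ∈ Finset.Ico n j, a k * R k ≤ ∑ k ∈ Finset.Ico n m, a k * R k :=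
        Finset.sum_le_sum_of_subset_of_nonneg (Finset.Ico_subset_Ico_right hj2)
          fun k hk _ => hterm k (Finset.mem_Ico.mp hk).1
      have h6 := mul_le_mul_of_nonneg_left h5 hx.const_nonneg
      have h7 : R j ≤ R m := runningMax_monotone hj2
      change ‖x j - x n‖ ≤ C * ∑ k ∈ Finset.Ico n j, a k * R k + 2 * R j * (1 / 4) at h2
      linarith
    have h8 : ∑ k ∈ Finset.Ico n m, (2 * C * a k) * R k
        = 2 * (C * ∑ k ∈ Finset.Ico n m, a k * R k) := by
      rw [Finset.mul_sum, Finset.mul_sum]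
      exact Finset.sum_congr rfl fun k _ => by ring
    linarith
  have := le_mul_exp_of_le_add_sum (mul_nonneg zero_le_two (hR0 n))
    (fun k hk => mul_nonneg (mul_nonneg zero_le_two hx.const_nonneg)
      (hx.stepsize_nonneg k (hn.trans hk))) (M := m) (fun m h _ => key m h le_rfl) hnm le_rfl
  rwa [← Finset.mul_sum] at this

end IsNormalizedScheme

namespace IsNormalizedScheme

variable {E : Type*} [NormedAddCommGroup E] [NormedSpace ℝ E] {x g N : ℕ → E} {a : ℕ → ℝ} {C : ℝ}

theorem sum_stepsize_mono (hx : IsNormalizedScheme x g N a C) {n k m : ℕ} (hn : 1 ≤ n)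
    (hkm : k ≤ m) : ∑ k ∈ Finset.Ico n k, a k ≤ ∑ k ∈ Finset.Ico n m, a k :=
  Finset.sum_le_sum_of_subset_of_nonneg (Finset.Ico_subset_Ico_right hkm)
    fun k hk _ => hx.stepsize_nonneg k (hn.trans (Finset.mem_Ico.mp hk).1)

/-- On windows of bounded ODE time, the rescaled iterates track the scaling-limit ODE. -/
theorem exists_tracking [ProperSpace E] (hx : IsNormalizedScheme x g N a C) {h hInf : E → E}
    {K : ℝ≥0} (hK : LipschitzWith K h)
    (hlim : ∀ x : E, Tendsto (fun c : ℝ => c⁻¹ • h (c • x)) atTop (𝓝 (hInf x)))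
    (h0 : hInf 0 = 0) (ha : Tendsto a atTop (𝓝 0))
    (herr : ∀ ε : ℝ, 0 < ε → ∀ᶠ n in atTop,
      ‖g n - h (x n)‖ ≤ ε * runningMax (fun k => ‖x k‖) n)
    {T : ℝ} (hT : 0 ≤ T) {ε : ℝ} (hε : 0 < ε) :
    ∃ r : ℝ, ∀ᶠ n in atTop, r ≤ runningMax (fun k => ‖x k‖) n →
      ∀ y : ℝ → E, IsIntegralCurveOn y (fun _ => hInf) (Ici 0) →
        y 0 = (runningMax (fun k => ‖x k‖) n)⁻¹ • x n →
        ∀ m, n ≤ m → ∑ k ∈ Finset.Ico n m, a k ≤ T →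
          ‖(runningMax (fun k => ‖x k‖) n)⁻¹ • x m - y (∑ k ∈ Finset.Ico n m, a k)‖ ≤ ε := by
  set R := runningMax (fun k => ‖x k‖) with hR
  have hInfK := lipschitzWith_scalingLimit hK hlim
  -- B bounds the rescaled iterates on the window and Y the ODE solution. Below, ε' is tuned so that
  -- Gronwall returns ε: 3 * T collects the drift, scaling-limit and Euler errors, 2 * B the noise.
  set B : ℝ := 2 * Real.exp (2 * C * T) with hB
  set Y : ℝ := Real.exp (K * T) with hY
  have hB0 : 0 < B := by positivity
  have hY0 : 0 < Y := by positivity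
  set ε' : ℝ := ε / ((3 * T + 2 * B) * Y) with hε'
  have hε'0 : 0 < ε' := by positivity
  obtain ⟨r, hr⟩ := eventually_atTop.mp (scalingLimit_uniform_on_ball hK hlim B hε'0)
  refine ⟨r, ?_⟩
  filter_upwards [eventually_ge_atTop 1, hx.eventually_noise_le hε'0,
    hx.eventually_noise_le (ε := 1 / 4) (by norm_num),
    eventually_forall_ge_atTop.mpr (herr (ε' / B) (by positivity)),
    eventually_forall_ge_atTop.mpr (ha.eventually_le_const
      (show (0 : ℝ) < ε' / (K * (K * Y) + 1) by positivity))]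
    with n hn hnoise hnoise4 hn_err hn_a hrn y hy hy0 m hnm hmT
  have hR0 : 0 < R n := runningMax_pos n
  set c := (R n)⁻¹ with hc
  have hc0 : 0 < c := inv_pos.mpr hR0
  set s : ℕ → ℝ := fun k => ∑ k ∈ Finset.Ico n k, a k with hs
  have hsn : s n = 0 := by simp [hs]
  have hsmono : ∀ {k l : ℕ}, k ≤ l → s k ≤ s l := fun hkl => hx.sum_stepsize_mono hn hkl
  have hs0 : ∀ k, n ≤ k → 0 ≤ s k := fun k hk => hsn ▸ hsmono hk
  have hssucc : ∀ k, n ≤ k → s (k + 1) = s k + a k := fun k hk => Finset.sum_Ico_succ_top hk a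
  have hRB : ∀ k, n ≤ k → k ≤ m → c * R k ≤ B := by
    intro k hk hkm
    have h1 := hx.runningMax_le_mul_exp hn hk hnoise4
    have h2 : Real.exp (2 * C * s k) ≤ Real.exp (2 * C * T) := by
      refine Real.exp_le_exp.mpr (mul_le_mul_of_nonneg_left ((hsmono hkm).trans hmT) ?_)
      exact mul_nonneg zero_le_two hx.const_nonneg
    calc c * R k ≤ c * (2 * R n * Real.exp (2 * C * s k)) := by gcongr
      _ = 2 * Real.exp (2 * C * s k) := by rw [hc]; field_simp
      _ ≤ B := by rw [hB]; linarith
  have hzB : ∀ k, n ≤ k → k ≤ m → ‖c • x k‖ ≤ B := by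
    intro k hk hkm
    rw [norm_smul, Real.norm_eq_abs, abs_of_pos hc0]
    exact (mul_le_mul_of_nonneg_left (le_runningMax_self (u := fun k => ‖x k‖) k) hc0.le).trans
      (hRB k hk hkm)
  have hy0n : ‖y 0‖ ≤ 1 := by
    rw [hy0, norm_smul, Real.norm_eq_abs, abs_of_pos hc0, hc, inv_mul_le_iff₀ hR0, mul_one]
    exact le_runningMax_self (u := fun k => ‖x k‖) n
  have hyY : ∀ t, 0 ≤ t → t ≤ T → ‖hInf (y t)‖ ≤ K * Y := by
    intro t ht htT
    have h1 := hInfK.dist_le_mul (y t) 0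
    rw [h0, dist_zero_right, dist_zero_right] at h1
    refine h1.trans (mul_le_mul_of_nonneg_left ?_ K.2)
    refine (norm_integralCurve_le hInfK h0 hy ht).trans ?_
    calc ‖y 0‖ * Real.exp (K * t) ≤ 1 * Real.exp (K * T) := by gcongr
      _ = Y := by rw [one_mul]
  set S : ℕ → E := fun k => ∑ k ∈ Finset.Ico n k, R k • (N (k + 1) - N k) with hS
  set e : ℕ → E := fun k => c • x k - y (s k) with he
  have hlocal : ∀ k, n ≤ k → k + 1 ≤ m →
      ‖a k • c • g k - (y (s (k + 1)) - y (s k))‖ ≤ a k * (3 * ε' + K * ‖e k‖) := by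
    intro k hk hkm
    have hak := hx.stepsize_nonneg k (hn.trans hk)
    have hsT : s k + a k ≤ T := by rw [← hssucc k hk]; exact (hsmono hkm).trans hmT
    have h1 : ‖c • (g k - h (x k))‖ ≤ ε' := by
      rw [norm_smul, Real.norm_eq_abs, abs_of_pos hc0]
      calc c * ‖g k - h (x k)‖ ≤ c * (ε' / B * R k) := by gcongr; exact hn_err k hk
        _ = ε' / B * (c * R k) := by ring
        _ ≤ ε' / B * B := by gcongr; exact hRB k hk (by omega)
        _ = ε' := by field_simp
    have h2 : ‖c • h (x k) - hInf (c • x k)‖ ≤ ε' := by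
      have := hr (R n) hrn (c • x k) (hzB k hk (by omega))
      rwa [smul_smul, hc, mul_inv_cancel₀ hR0.ne', one_smul, ← hc] at this
    have h3 : ‖hInf (c • x k) - hInf (y (s k))‖ ≤ K * ‖e k‖ := by
      simpa [dist_eq_norm] using hInfK.dist_le_mul (c • x k) (y (s k))
    have h4 : ‖y (s k + a k) - y (s k) - a k • hInf (y (s k))‖ ≤ a k * ε' := by
      refine (norm_integralCurve_sub_euler_le hInfK hy (hs0 k hk) hak (C := K * Y)
        fun u hu => hyY u ((hs0 k hk).trans hu.1) (hu.2.trans hsT)).trans ?_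
      have h5 : (K : ℝ) * (K * Y) * a k ≤ ε' := by
        have h6 : 0 ≤ (K : ℝ) * (K * Y) := by positivity
        calc (K : ℝ) * (K * Y) * a k ≤ (K * (K * Y) + 1) * (ε' / (K * (K * Y) + 1)) :=
              mul_le_mul (by linarith) (hn_a k hk) hak (by positivity)
          _ = ε' := by field_simp
      rw [mul_comm (a k)]
      exact mul_le_mul_of_nonneg_right h5 hak
    rw [hssucc k hk]
    have h7 : a k • c • g k - (y (s k + a k) - y (s k))
        = a k • (c • (g k - h (x k)) + (c • h (x k) - hInf (c • x k))
          + (hInf (c • x k) - hInf (y (s k))))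
          - (y (s k + a k) - y (s k) - a k • hInf (y (s k))) := by
      simp only [smul_add, smul_sub]; abel
    rw [h7]
    refine (norm_sub_le _ _).trans ?_
    rw [norm_smul, Real.norm_eq_abs, abs_of_nonneg hak]
    have h8 := mul_le_mul_of_nonneg_left
      ((norm_add₃_le (a := c • (g k - h (x k))) (b := c • h (x k) - hInf (c • x k))
        (c := hInf (c • x k) - hInf (y (s k)))).trans (add_le_add (add_le_add h1 h2) h3)) hak
    linarith
  -- The accumulated noise is split off before summing local errors, since it is small only as a
  -- whole and not term by term in norm.
  have hmain : ∀ k, n ≤ k → k ≤ m →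
      ‖e k - c • S k‖ ≤ ∑ j ∈ Finset.Ico n k, a j * (3 * ε' + K * ‖e j‖) := by
    intro k hk
    induction k, hk using Nat.le_induction with
    | base => intro _; simp [he, hS, hsn, hy0]
    | succ k hk ih =>
      intro hkm
      rw [Finset.sum_Ico_succ_top hk]
      have h1 : e (k + 1) - c • S (k + 1)
          = (e k - c • S k) + (a k • c • g k - (y (s (k + 1)) - y (s k))) := by
        have hSs : S (k + 1) = S k + R k • (N (k + 1) - N k) := Finset.sum_Ico_succ_top hk _
        simp only [he]
        rw [hSs, hx.step k (hn.trans hk), smul_comm (a k) c]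
        simp only [smul_add, smul_sub, hR]
        abel
      rw [h1]
      exact (norm_add_le _ _).trans (add_le_add (ih (by omega)) (hlocal k hk hkm))
  have hnoiseS : ∀ k, n ≤ k → k ≤ m → ‖c • S k‖ ≤ 2 * B * ε' := by
    intro k hk hkm
    have h1 := norm_sum_smul_sub_le (R := R) runningMax_monotone
      (fun k => (runningMax_pos k).le) hnoise hk
    rw [norm_smul, Real.norm_eq_abs, abs_of_pos hc0]
    calc c * ‖S k‖ ≤ c * (2 * R k * ε') := by gcongr
      _ = 2 * (c * R k) * ε' := by ring
      _ ≤ 2 * B * ε' := by gcongr; exact hRB k hk hkm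
  have hgron : ∀ k, n ≤ k → k ≤ m →
      ‖e k‖ ≤ (3 * T + 2 * B) * ε' + ∑ j ∈ Finset.Ico n k, (K * a j) * ‖e j‖ := by
    intro k hk hkm
    have h1 := hmain k hk hkm
    have h2 := hnoiseS k hk hkm
    have h3 := norm_sub_norm_le (e k) (c • S k)
    have h4 : ∑ j ∈ Finset.Ico n k, a j * (3 * ε' + K * ‖e j‖)
        = 3 * ε' * s k + ∑ j ∈ Finset.Ico n k, (K * a j) * ‖e j‖ := by
      rw [hs, Finset.mul_sum, ← Finset.sum_add_distrib]
      exact Finset.sum_congr rfl fun j _ => by ring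
    have h5 : 3 * ε' * s k ≤ 3 * ε' * T :=
      mul_le_mul_of_nonneg_left ((hsmono hkm).trans hmT) (by positivity)
    linarith
  have hfin := le_mul_exp_of_le_add_sum (v := fun k => ‖e k‖) (by positivity)
    (fun k hk => mul_nonneg K.2 (hx.stepsize_nonneg k (hn.trans hk))) hgron hnm le_rfl
  rw [← Finset.mul_sum] at hfin
  refine hfin.trans ?_
  have hexp : Real.exp (K * ∑ k ∈ Finset.Ico n m, a k) ≤ Y :=
    Real.exp_le_exp.mpr (mul_le_mul_of_nonneg_left hmT K.2)
  calc (3 * T + 2 * B) * ε' * Real.exp (K * ∑ k ∈ Finset.Ico n m, a k)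
      ≤ (3 * T + 2 * B) * ε' * Y := by gcongr
    _ = ε := by rw [hε']; field_simp

/-- **Stability of normalized schemes**: if the drift is asymptotically `h` and the scaling limit
of `h` is globally asymptotically stable, then the iterates are bounded. -/
theorem bddAbove_norm [ProperSpace E] (hx : IsNormalizedScheme x g N a C) {h : E → E}
    {K : ℝ≥0} (hK : LipschitzWith K h) (hscale : HasStableScalingLimit h)
    (ha : Tendsto a atTop (𝓝 0))
    (hsum : Tendsto (fun m => ∑ k ∈ Finset.Ico 1 m, a k) atTop atTop)
    (herr : ∀ ε : ℝ, 0 < ε → ∀ᶠ n in atTop,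
      ‖g n - h (x n)‖ ≤ ε * runningMax (fun k => ‖x k‖) n) :
    BddAbove (Set.range fun n => ‖x n‖) := by
  obtain ⟨hInf, -, hlim, hstab⟩ := hscale
  have hInfK := lipschitzWith_scalingLimit hK hlim
  set R := runningMax (fun k => ‖x k‖) with hR
  -- An ODE bound of 1 / 2 plus a tracking error of 1 / 2 keeps the rescaled iterates below 1;
  -- likewise δ / 2 + δ / 2 gives δ at the end of a window. The horizon T + 1 allows for
  -- overshooting T by one stepsize, eventually at most 1.
  obtain ⟨δ, hδ, hδstab⟩ := hstab.stable (1 / 2) (by norm_num)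
  obtain ⟨T, hT, hTattr⟩ := hstab.uniform_attractive hInfK 1 (half_pos hδ)
  obtain ⟨r, hr⟩ := hx.exists_tracking hK hlim hstab.equilibrium ha herr (T := T + 1)
    (by linarith) (ε := min (δ / 2) (1 / 2)) (by positivity)
  obtain ⟨n₀, hn₀⟩ := eventually_atTop.mp
    (((hr.and (eventually_ge_atTop 1))).and
      (eventually_forall_ge_atTop.mpr (ha.eventually_le_const one_pos)))
  have hRpos : ∀ n, 0 < R n := fun n => runningMax_pos n
  have hnorm : ∀ n, ‖x n‖ ≤ R n := fun n => le_runningMax_self (u := fun k => ‖x k‖) n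
  have hstart : ∀ n, ∃ y : ℝ → E, y 0 = (R n)⁻¹ • x n ∧
      IsIntegralCurveOn y (fun _ => hInf) (Ici 0) ∧ ‖y 0‖ ≤ 1 := by
    intro n
    obtain ⟨y, hy0, hy⟩ := exists_integralCurve_Ici hInfK ((R n)⁻¹ • x n)
    refine ⟨y, hy0, hy, ?_⟩
    rw [hy0, norm_smul, norm_inv, Real.norm_eq_abs, abs_of_pos (hRpos n),
      inv_mul_le_iff₀ (hRpos n), mul_one]
    exact hnorm n
  have hrescale : ∀ n m : ℕ, ∀ b : ℝ, ‖(R n)⁻¹ • x m‖ < b → ‖x m‖ < b * R n := by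
    intro n m b hb
    rwa [norm_smul, norm_inv, Real.norm_eq_abs, abs_of_pos (hRpos n), inv_mul_lt_iff₀ (hRpos n),
      mul_comm] at hb
  have hwindow : ∀ n, n₀ ≤ n → ∃ m, n < m ∧ T ≤ ∑ k ∈ Finset.Ico n m, a k ∧
      ∑ k ∈ Finset.Ico n m, a k ≤ T + 1 := by
    intro n hn
    have hn1 : 1 ≤ n := (hn₀ n hn).1.2
    have hex : ∃ m, n ≤ m ∧ T ≤ ∑ k ∈ Finset.Ico n m, a k := by
      obtain ⟨m, hm1, hm2⟩ := ((hsum.eventually_ge_atTop (T + ∑ k ∈ Finset.Ico 1 n, a k)).and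
        (eventually_ge_atTop n)).exists
      refine ⟨m, hm2, ?_⟩
      have := Finset.sum_Ico_consecutive a hn1 hm2
      linarith
    classical
    obtain ⟨h1, h2⟩ := Nat.find_spec hex
    have hne : n ≠ Nat.find hex := by
      intro heq
      rw [← heq] at h2
      simp only [Finset.Ico_self, Finset.sum_empty] at h2
      linarith
    have hlt : n < Nat.find hex := lt_of_le_of_ne h1 hne
    refine ⟨Nat.find hex, hlt, h2, ?_⟩
    obtain ⟨l, hl⟩ : ∃ l, Nat.find hex = l + 1 := ⟨Nat.find hex - 1, by omega⟩
    have hmin := Nat.find_min hex (m := l) (by omega)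
    rw [hl] at hlt ⊢
    rw [Finset.sum_Ico_succ_top (by omega)]
    have h3 : ∑ k ∈ Finset.Ico n l, a k < T := by
      by_contra hcon
      exact hmin ⟨by omega, not_lt.mp hcon⟩
    have h4 := (hn₀ n hn).2 l (by omega)
    linarith
  by_contra hunb
  -- If R never reached the tracking threshold r after n₀, the iterates would already be bounded.
  have hlarge : ∃ n, n₀ ≤ n ∧ r ≤ R n := by
    by_contra hcon
    push Not at hcon
    refine hunb ⟨max (R n₀) r, ?_⟩
    rintro _ ⟨n, rfl⟩
    rcases le_or_gt n₀ n with h | h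
    · exact ((hnorm n).trans (hcon n h).le).trans (le_max_right _ _)
    · exact (le_runningMax (u := fun k => ‖x k‖) h.le).trans (le_max_left _ _)
  obtain ⟨n₁, hn₁, hrn₁⟩ := hlarge
  have hsmall : ∀ n m, n₀ ≤ n → r ≤ R n → n ≤ m → T ≤ ∑ k ∈ Finset.Ico n m, a k →
      ∑ k ∈ Finset.Ico n m, a k ≤ T + 1 → ‖x m‖ < δ * R n := by
    intro n m hn hrn hnm h1 h2
    obtain ⟨y, hy0, hy, hy1⟩ := hstart n
    have h3 := (hn₀ n hn).1.1 hrn y hy hy0 m hnm h2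
    have h4 := hTattr y hy hy1 _ h1
    have h5 := norm_sub_norm_le ((R n)⁻¹ • x m) (y (∑ k ∈ Finset.Ico n m, a k))
    have h6 := min_le_left (δ / 2) (1 / 2)
    exact hrescale n m δ (by linarith)
  -- The state "norm below δ * R" reproduces itself over a window, during which no new maximum is
  -- attained.
  have hinv : ∀ n, n₀ ≤ n → r ≤ R n → ‖x n‖ < δ * R n →
      ∃ m, n < m ∧ ‖x m‖ < δ * R m ∧ R m = R n := by
    intro n hn hrn hxn
    obtain ⟨m, hm, h1, h2⟩ := hwindow n hn
    have hRm : R m = R n := by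
      refine le_antisymm (runningMax_le hm.le le_rfl fun j hj1 hj2 => ?_)
        (runningMax_monotone hm.le)
      obtain ⟨y, hy0, hy, hy1⟩ := hstart n
      have hn1 : 1 ≤ n := (hn₀ n hn).1.2
      have h3 := (hn₀ n hn).1.1 hrn y hy hy0 j hj1.le ((hx.sum_stepsize_mono hn1 hj2).trans h2)
      have h4 : ‖y (∑ k ∈ Finset.Ico n j, a k)‖ < 1 / 2 := by
        refine hδstab y hy ?_ _ (Finset.sum_nonneg fun k hk =>
          hx.stepsize_nonneg k (hn1.trans (Finset.mem_Ico.mp hk).1))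
        rw [hy0, norm_smul, norm_inv, Real.norm_eq_abs, abs_of_pos (hRpos n),
          inv_mul_lt_iff₀ (hRpos n), mul_comm]
        exact hxn
      have h5 := norm_sub_norm_le ((R n)⁻¹ • x j) (y (∑ k ∈ Finset.Ico n j, a k))
      have h6 := min_le_right (δ / 2) (1 / 2)
      have := hrescale n j 1 (by linarith)
      linarith
    exact ⟨m, hm, by rw [hRm]; exact hsmall n m hn hrn hm.le h1 h2, hRm⟩
  obtain ⟨n₂, hn₂, h1, h2⟩ := hwindow n₁ hn₁
  have hx₂ : ‖x n₂‖ < δ * R n₂ :=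
    (hsmall n₁ n₂ hn₁ hrn₁ hn₂.le h1 h2).trans_le
      (mul_le_mul_of_nonneg_left (runningMax_monotone hn₂.le) hδ.le)
  have hiter : ∀ k : ℕ, ∃ m, n₂ + k ≤ m ∧ ‖x m‖ < δ * R m ∧ R m = R n₂ := by
    intro k
    induction k with
    | zero => exact ⟨n₂, le_rfl, hx₂, rfl⟩
    | succ k ih =>
      obtain ⟨m, hm1, hm2, hm3⟩ := ih
      have hrm : r ≤ R m := by
        rw [hm3]; exact hrn₁.trans (runningMax_monotone hn₂.le)
      obtain ⟨m', hm'1, hm'2, hm'3⟩ := hinv m (by omega) hrm hm2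
      exact ⟨m', by omega, hm'2, hm'3.trans hm3⟩
  refine hunb ⟨R n₂, ?_⟩
  rintro _ ⟨n, rfl⟩
  obtain ⟨m, hm1, -, hm3⟩ := hiter n
  rw [← hm3]
  exact le_runningMax (u := fun k => ‖x k‖) (by omega)

end IsNormalizedScheme

/-! ### Power stepsizes and the ODE time spanned by delays. -/

/-- Both rules are powers, with β = 1 or β = 1 / q. Here β > 1 / 2 gives square summability, β ≤ 1 a
divergent sum, and 1 < β * p the Borel–Cantelli series for ages of order n ^ β. -/
theorem IsStepsizeFor.exists_power {p : ℝ} {a : ℕ → ℝ} (ha : IsStepsizeFor p a) :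
    ∃ α β : ℝ, 0 < α ∧ 1 / 2 < β ∧ β ≤ 1 ∧ (β = 1 ∨ 1 < β * p) ∧
      ∀ n : ℕ, 1 ≤ n → a n = α * (n : ℝ) ^ (-β) := by
  obtain ⟨α, hα, h1, h2⟩ := ha
  rcases le_or_gt p 1 with hp | hp
  · refine ⟨α, 1, hα, by norm_num, le_rfl, Or.inl rfl, fun n hn => ?_⟩
    rw [h1 hp n hn, Real.rpow_neg_one, div_eq_mul_inv]
  · obtain ⟨q, hq1, hq2, hq⟩ := h2 hp
    have hq0 : 0 < q := by linarith
    refine ⟨α, 1 / q, hα, ?_, ?_, Or.inr ?_, hq⟩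
    · exact one_div_lt_one_div_of_lt hq0 (hq2.trans_le (min_le_left _ _))
    · rw [div_le_one hq0]; exact hq1.le
    · rw [div_mul_eq_mul_div, one_mul, one_lt_div hq0]
      exact hq2.trans_le (min_le_right _ _)

section PowerStepsize

variable {a : ℕ → ℝ} {α β : ℝ}

theorem tendsto_powerStepsize (hβ : 0 < β) (ha : ∀ n : ℕ, 1 ≤ n → a n = α * (n : ℝ) ^ (-β)) :
    Tendsto a atTop (𝓝 0) := by
  have h1 := ((tendsto_rpow_neg_atTop hβ).comp tendsto_natCast_atTop_atTop).const_mul α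
  rw [mul_zero] at h1
  refine h1.congr' ?_
  filter_upwards [eventually_ge_atTop 1] with n hn
  exact (ha n hn).symm

theorem tendsto_sum_powerStepsize (hα : 0 < α) (hβ : β ≤ 1)
    (ha : ∀ n : ℕ, 1 ≤ n → a n = α * (n : ℝ) ^ (-β)) :
    Tendsto (fun m => ∑ k ∈ Finset.Ico 1 m, a k) atTop atTop := by
  have h1 : ¬ Summable fun n : ℕ => α * (n : ℝ) ^ (-β) := by
    rw [summable_mul_left_iff hα.ne', Real.summable_nat_rpow]
    linarith
  have h2 := (not_summable_iff_tendsto_nat_atTop_of_nonneg (fun n => by positivity)).mp h1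
  -- The sums start at 1, so the conventional value of the term at 0 is removed.
  have h3 := tendsto_atTop_add_const_right atTop (-(α * ((0 : ℕ) : ℝ) ^ (-β))) h2
  refine h3.congr' ?_
  filter_upwards [eventually_ge_atTop 1] with m hm
  have h4 : ∑ k ∈ Finset.Ico 1 m, a k = ∑ k ∈ Finset.Ico 1 m, α * (k : ℝ) ^ (-β) :=
    Finset.sum_congr rfl fun k hk => ha k (Finset.mem_Ico.mp hk).1
  rw [h4, Finset.range_eq_Ico, Finset.sum_eq_sum_Ico_succ_bot (by omega : 0 < m)]
  ring

theorem summable_sq_powerStepsize (hβ : 1 / 2 < β)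
    (ha : ∀ n : ℕ, 1 ≤ n → a n = α * (n : ℝ) ^ (-β)) : Summable fun n => a (n + 1) ^ 2 := by
  have h1 : Summable fun n : ℕ => α ^ 2 * (n : ℝ) ^ (-(2 * β)) :=
    (Real.summable_nat_rpow.mpr (by linarith)).mul_left _
  refine ((summable_nat_add_iff 1).mpr h1).congr fun n => ?_
  rw [ha (n + 1) (by omega), mul_pow, ← Real.rpow_natCast (((n + 1 : ℕ) : ℝ) ^ (-β)) 2,
    ← Real.rpow_mul (by positivity)]
  congr 2
  push_cast
  ring

/-- If the delay is `o(n ^ β)`, then it spans a vanishing amount of ODE time. -/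
theorem eventually_sum_lag_le (hα : 0 < α) (hβ0 : 0 < β) (hβ : β ≤ 1)
    (ha : ∀ n : ℕ, 1 ≤ n → a n = α * (n : ℝ) ^ (-β)) {τ : ℕ → ℕ}
    (hτ : Tendsto (fun n => (τ n : ℝ) / (n : ℝ) ^ β) atTop (𝓝 0)) {ε : ℝ} (hε : 0 < ε) :
    ∀ᶠ n in atTop, n ≤ 2 * (n - τ n) ∧ ∑ k ∈ Finset.Ico (n - τ n) n, a k ≤ ε := by
  filter_upwards [eventually_ge_atTop 1, hτ.eventually_le_const (show (0 : ℝ) < 1 / 2 by norm_num),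
    hτ.eventually_le_const (show (0 : ℝ) < ε / (2 * α) by positivity)] with n hn h1 h2
  have hn0 : (0 : ℝ) < n := by exact_mod_cast hn
  have hn1 : (1 : ℝ) ≤ n := by exact_mod_cast hn
  have hnβ : (0 : ℝ) < (n : ℝ) ^ β := Real.rpow_pos_of_pos hn0 β
  have hhalf : 2 * τ n ≤ n := by
    have h3 : (n : ℝ) ^ β ≤ n := by
      simpa using Real.rpow_le_rpow_of_exponent_le hn1 hβ
    have h4 : (τ n : ℝ) ≤ 1 / 2 * (n : ℝ) ^ β := (div_le_iff₀ hnβ).mp h1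
    have : (2 : ℝ) * τ n ≤ n := by linarith
    exact_mod_cast this
  refine ⟨by omega, ?_⟩
  -- Every index in the window is at least n / 2, so each of the τ n stepsizes is comparable to the
  -- one at n.
  have hterm : ∀ k ∈ Finset.Ico (n - τ n) n, a k ≤ 2 * α / (n : ℝ) ^ β := by
    intro k hk
    rw [Finset.mem_Ico] at hk
    have hk1 : 1 ≤ k := by omega
    have hk2 : (n : ℝ) / 2 ≤ k := by
      have : (n : ℝ) ≤ 2 * k := by exact_mod_cast (by omega : n ≤ 2 * k)
      linarith
    have h5 : (n : ℝ) ^ β ≤ 2 * (k : ℝ) ^ β := by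
      calc (n : ℝ) ^ β = 2 ^ β * ((n : ℝ) / 2) ^ β := by
            rw [← Real.mul_rpow (by norm_num) (by positivity)]; congr 1; ring
        _ ≤ 2 ^ (1 : ℝ) * (k : ℝ) ^ β := by
            gcongr
            exact one_le_two
        _ = 2 * (k : ℝ) ^ β := by rw [Real.rpow_one]
    have hkβ : (0 : ℝ) < (k : ℝ) ^ β := Real.rpow_pos_of_pos (by exact_mod_cast hk1) β
    rw [ha k hk1, Real.rpow_neg (by positivity), ← div_eq_mul_inv, div_le_div_iff₀ hkβ hnβ]
    nlinarith
  refine (Finset.sum_le_card_nsmul _ _ _ hterm).trans ?_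
  have hcard : (Finset.Ico (n - τ n) n).card = τ n := by rw [Nat.card_Ico]; omega
  rw [hcard, nsmul_eq_mul]
  calc (τ n : ℝ) * (2 * α / (n : ℝ) ^ β) = (τ n : ℝ) / (n : ℝ) ^ β * (2 * α) := by ring
    _ ≤ ε / (2 * α) * (2 * α) := by gcongr
    _ = ε := by field_simp

end PowerStepsize

/-! ### Almost sure growth of stochastically dominated ages. -/

section Domination

variable {Ω Ω' : Type*} [MeasurableSpace Ω] [MeasurableSpace Ω'] {P : Measure Ω} {P' : Measure Ω'}

/-- Markov's inequality is applied to the p-th power of the dominating variable, on its own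
probability space. -/
theorem StochDominatedBy.measure_lt_le [IsFiniteMeasure P'] {X : Ω → ℝ} {Y : Ω' → ℝ}
    (hXY : StochDominatedBy P P' X Y) (hY : ∀ᵐ ω ∂P', 0 ≤ Y ω) {p : ℝ} (hp : 0 < p)
    (hint : Integrable (fun ω => Y ω ^ p) P') {r : ℝ} (hr : 0 < r) :
    P {ω | r < X ω} ≤ ENNReal.ofReal ((∫ ω, Y ω ^ p ∂P') * r ^ (-p)) := by
  have h1 := mul_meas_ge_le_integral_of_nonneg (μ := P') (f := fun ω => Y ω ^ p)
    (hY.mono fun ω h => Real.rpow_nonneg h p) hint (r ^ p)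
  have hrp : 0 < r ^ p := Real.rpow_pos_of_pos hr p
  calc P {ω | r < X ω} ≤ P' {ω | r < Y ω} := hXY r hr.le
    _ ≤ P' {ω | r ^ p ≤ Y ω ^ p} :=
        measure_mono fun ω (hω : r < Y ω) => Real.rpow_le_rpow hr.le hω.le hp.le
    _ = ENNReal.ofReal (P'.real {ω | r ^ p ≤ Y ω ^ p}) := (ofReal_measureReal).symm
    _ ≤ _ := by
        refine ENNReal.ofReal_le_ofReal ?_
        rw [Real.rpow_neg hr.le, ← div_eq_mul_inv, le_div_iff₀ hrp, mul_comm]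
        exact h1

/-- Borel–Cantelli for nonnegative random variables that are dominated by a variable with finite
`p`-th moment. -/
theorem ae_tendsto_div_of_stochDominatedBy [IsFiniteMeasure P'] {X : ℕ → Ω → ℝ} {Y : Ω' → ℝ}
    (hX : ∀ k ω, 0 ≤ X k ω)
    (hXY : ∀ k, StochDominatedBy P P' (X k) Y) (hY : ∀ᵐ ω ∂P', 0 ≤ Y ω) {p : ℝ} (hp : 0 < p)
    (hint : Integrable (fun ω => Y ω ^ p) P') {v : ℕ → ℝ} (hv : ∀ k, 0 < v k)
    (hsum : Summable fun k => v k ^ (-p)) :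
    ∀ᵐ ω ∂P, Tendsto (fun k => X k ω / v k) atTop (𝓝 0) := by
  -- Countably many thresholds 1 / (j + 1) suffice, so the exceptional null sets can be united.
  have key : ∀ j : ℕ, ∀ᵐ ω ∂P, ∀ᶠ k in atTop, ω ∉ {ω | (1 / ((j : ℝ) + 1)) * v k < X k ω} := by
    intro j
    have hj : 0 < 1 / ((j : ℝ) + 1) := Nat.one_div_pos_of_nat
    refine ae_eventually_notMem ?_
    have hs : Summable fun k => (∫ ω, Y ω ^ p ∂P') * ((1 / ((j : ℝ) + 1)) * v k) ^ (-p) := by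
      refine ((hsum.mul_left ((1 / ((j : ℝ) + 1)) ^ (-p))).congr fun k => ?_).mul_left _
      rw [Real.mul_rpow hj.le (hv k).le]
    refine ne_top_of_le_ne_top hs.tsum_ofReal_ne_top (ENNReal.tsum_le_tsum fun k => ?_)
    exact (hXY k).measure_lt_le hY hp hint (mul_pos hj (hv k))
  filter_upwards [ae_all_iff.mpr key] with ω hω
  rw [Metric.tendsto_atTop']
  intro ε hε
  obtain ⟨j, hj⟩ := exists_nat_one_div_lt hε
  obtain ⟨n, hn⟩ := eventually_atTop.mp (hω j)
  refine ⟨n, fun k hk => ?_⟩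
  have h1 : X k ω ≤ (1 / ((j : ℝ) + 1)) * v k := not_lt.mp (hn k hk.le)
  rw [Real.dist_eq, sub_zero, abs_of_nonneg (div_nonneg (hX k ω) (hv k).le)]
  exact ((div_le_iff₀ (hv k)).mpr h1).trans_lt hj

end Domination

/-- For an age process, sublinear growth along the sequence `k ^ s` implies sublinear growth. -/
theorem tendsto_age_div_of_tendsto_pow {τ m : ℕ → ℕ}
    (hm : ∀ n, 1 ≤ n → m n ≤ n ∧ m n ≤ m (n + 1) ∧ τ n = n - m n) {s : ℕ} (hs : s ≠ 0)
    (hlim : Tendsto (fun k : ℕ => (τ (k ^ s) : ℝ) / ((k : ℝ) ^ s)) atTop (𝓝 0)) :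
    Tendsto (fun n : ℕ => (τ n : ℝ) / n) atTop (𝓝 0) := by
  have hmono : ∀ k n, 1 ≤ k → k ≤ n → m k ≤ m n := by
    intro k n hk hkn
    induction n, hkn using Nat.le_induction with
    | base => exact le_rfl
    | succ n hn ih => exact ih.trans (hm n (hk.trans hn)).2.1
  -- κ n is the integer s-th root of n, so n lies between consecutive sampling times κ n ^ s and (κ
  -- n + 1) ^ s.
  set κ : ℕ → ℕ := fun n => Nat.findGreatest (fun k => k ^ s ≤ n) n with hκ
  have hκle : ∀ n, κ n ^ s ≤ n := fun n => by
    have : (fun k => k ^ s ≤ n) (κ n) :=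
      Nat.findGreatest_spec (P := fun k => k ^ s ≤ n) (Nat.zero_le n) (by simp [hs])
    exact this
  have hle : ∀ K n, K ^ s ≤ n → K ≤ κ n := fun K n h =>
    Nat.le_findGreatest ((Nat.le_self_pow hs K).trans h) h
  have hκlt : ∀ n, n < (κ n + 1) ^ s := fun n => by
    by_contra hcon
    have := hle (κ n + 1) n (not_lt.mp hcon)
    omega
  have hκtop : Tendsto κ atTop atTop := by
    rw [tendsto_atTop]
    intro K
    filter_upwards [eventually_ge_atTop (K ^ s)] with n hn
    exact hle K n hn
  have hlim2 : Tendsto (fun k : ℕ => (1 + 1 / (k : ℝ)) ^ s - 1 + (τ (k ^ s) : ℝ) / ((k : ℝ) ^ s))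
      atTop (𝓝 0) := by
    have h1 := ((tendsto_one_div_atTop_nhds_zero_nat (𝕜 := ℝ)).const_add 1).pow s
    have h2 := (h1.sub_const 1).add hlim
    simpa using h2
  refine squeeze_zero' (Eventually.of_forall fun n => by positivity) ?_ (hlim2.comp hκtop)
  filter_upwards [eventually_ge_atTop 1] with n hn
  have hk1 : 1 ≤ κ n := hle 1 n (by simpa using hn)
  set k := κ n with hk
  have hks : 1 ≤ k ^ s := Nat.one_le_pow _ _ hk1
  have hkpos : (0 : ℝ) < (k : ℝ) ^ s := by exact_mod_cast hks
  have h1 := hm n hn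
  have h2 := hm (k ^ s) hks
  have h3 := hmono _ _ hks (hκle n)
  have h4 : n < (k + 1) ^ s := hκlt n
  -- Time stamps never decrease, so since time k ^ s the age has grown by at most the elapsed time,
  -- itself o(k ^ s).
  have h5 : τ n + k ^ s ≤ (k + 1) ^ s + τ (k ^ s) := by omega
  have h6 : (τ n : ℝ) + (k : ℝ) ^ s ≤ ((k : ℝ) + 1) ^ s + τ (k ^ s) := by exact_mod_cast h5
  have h7 : (k : ℝ) ^ s ≤ n := by exact_mod_cast hκle n
  have hk0 : (0 : ℝ) < k := by exact_mod_cast hk1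
  calc (τ n : ℝ) / n ≤ (τ n : ℝ) / (k : ℝ) ^ s := by gcongr
    _ ≤ (((k : ℝ) + 1) ^ s - (k : ℝ) ^ s + τ (k ^ s)) / (k : ℝ) ^ s := by gcongr; linarith
    _ = (1 + 1 / (k : ℝ)) ^ s - 1 + (τ (k ^ s) : ℝ) / (k : ℝ) ^ s := by
        have : 1 + 1 / (k : ℝ) = ((k : ℝ) + 1) / k := by field_simp
        rw [this, div_pow]; field_simp

/-- An age process that is dominated by a variable with finite `p`-th moment is almost surely
`o(n ^ β)`, where `β = 1` or `β p > 1`. -/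
theorem IsAoIP.ae_tendsto_div_rpow {Ω Ω' : Type*} [MeasurableSpace Ω] [MeasurableSpace Ω']
    {P : Measure Ω} {P' : Measure Ω'} [IsFiniteMeasure P'] {τ : ℕ → Ω → ℕ} (hτ : IsAoIP τ)
    {Y : Ω' → ℝ} (hdom : ∀ n, 1 ≤ n → StochDominatedBy P P' (fun ω => (τ n ω : ℝ)) Y)
    (hY : ∀ᵐ ω ∂P', 0 ≤ Y ω) {p : ℝ} (hp : 0 < p) (hint : Integrable (fun ω => Y ω ^ p) P')
    {β : ℝ} (hβ : β = 1 ∨ 1 < β * p) :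
    ∀ᵐ ω ∂P, Tendsto (fun n => (τ n ω : ℝ) / (n : ℝ) ^ β) atTop (𝓝 0) := by
  rcases hβ with rfl | hβ
  -- For small p the tails are not summable along all n, but they are along n = k ^ s with s * p >
  -- 1; the age structure fills the gaps.
  · obtain ⟨s, hs⟩ := exists_nat_gt (1 / p)
    have hs0 : s ≠ 0 := by
      rintro rfl
      have : 0 < 1 / p := by positivity
      norm_num at hs
      linarith [inv_pos.mpr hp]
    have hsp : 1 < s * p := by rwa [div_lt_iff₀ hp] at hs
    have hsum : Summable fun k : ℕ => (((k + 1 : ℕ) : ℝ) ^ s) ^ (-p) := by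
      have h1 : Summable fun k : ℕ => (k : ℝ) ^ (-(s * p)) :=
        Real.summable_nat_rpow.mpr (by linarith)
      refine ((summable_nat_add_iff 1).mpr h1).congr fun k => ?_
      rw [← Real.rpow_natCast, ← Real.rpow_mul (by positivity)]
      congr 1; ring
    have h1 := ae_tendsto_div_of_stochDominatedBy (P := P)
      (X := fun k ω => (τ ((k + 1) ^ s) ω : ℝ)) (fun _ _ => Nat.cast_nonneg _)
      (fun k => hdom _ (Nat.one_le_pow _ _ k.succ_pos)) hY hp hint
      (fun k => by positivity) hsum
    obtain ⟨m, -, hm⟩ := hτ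
    filter_upwards [h1] with ω hω
    simp only [Real.rpow_one]
    refine tendsto_age_div_of_tendsto_pow (τ := fun n => τ n ω) (m := fun n => m n ω)
      (fun n hn => hm n hn ω) hs0 ?_
    rw [← tendsto_add_atTop_iff_nat 1]
    exact hω
  · have hsum : Summable fun k : ℕ => (((k + 1 : ℕ) : ℝ) ^ β) ^ (-p) := by
      have h1 : Summable fun k : ℕ => (k : ℝ) ^ (-(β * p)) :=
        Real.summable_nat_rpow.mpr (by linarith)
      refine ((summable_nat_add_iff 1).mpr h1).congr fun k => ?_
      rw [← Real.rpow_mul (by positivity)]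
      congr 1; ring
    have h1 := ae_tendsto_div_of_stochDominatedBy (P := P)
      (X := fun k ω => (τ (k + 1) ω : ℝ)) (fun _ _ => Nat.cast_nonneg _)
      (fun k => hdom _ (by omega)) hY hp hint
      (fun k => by positivity) hsum
    filter_upwards [h1] with ω hω
    rw [← tendsto_add_atTop_iff_nat 1]
    exact hω

/-! ### Conditional expectations with values in [0, ∞]. -/

section ConditionalLExp

/-- The measures with densities X and its conditional expectation agree on m, hence integrate
m-measurable weights alike. No integrability is needed, so it applies before the noise is known to
be square integrable. -/
theorem lintegral_mul_condLExp {Ω : Type*} {m mΩ : MeasurableSpace Ω} (hm : m ≤ mΩ)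
    (P : Measure Ω) [SigmaFinite (P.trim hm)] {w X : Ω → ℝ≥0∞} (hw : Measurable[m] w)
    (hX : Measurable X) : ∫⁻ ω, w ω * P⁻[X|m] ω ∂P = ∫⁻ ω, w ω * X ω ∂P := by
  have hC : Measurable (P⁻[X|m]) := measurable_condLExp' m P X
  have hw' : Measurable w := hw.mono hm le_rfl
  have htrim : (P.withDensity (P⁻[X|m])).trim hm = (P.withDensity X).trim hm := by
    refine @Measure.ext Ω m _ _ fun s hs => ?_
    rw [trim_measurableSet_eq hm hs, trim_measurableSet_eq hm hs, withDensity_apply _ (hm s hs),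
      withDensity_apply _ (hm s hs), setLIntegral_condLExp (hm := hm) P X hs]
  have h1 := lintegral_withDensity_eq_lintegral_mul P hC hw'
  have h2 := lintegral_withDensity_eq_lintegral_mul P hX hw'
  have h3 : ∫⁻ ω, w ω ∂(P.withDensity (P⁻[X|m])) = ∫⁻ ω, w ω ∂(P.withDensity X) := by
    rw [← lintegral_trim hm hw, ← lintegral_trim hm hw, htrim]
  simp only [h1, h2, Pi.mul_apply] at h3
  simpa only [mul_comm] using h3

end ConditionalLExp

/-! ### Convergence of L²-bounded martingales. -/

section L2Martingale

variable {Ω : Type*} {mΩ : MeasurableSpace Ω} {P : Measure Ω} [IsProbabilityMeasure P]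

/-- A martingale whose increments have summable second moments converges almost surely. -/
theorem ae_exists_tendsto_sum_of_condExp_eq_zero {ℱ : Filtration ℕ mΩ} {ξ : ℕ → Ω → ℝ}
    (hadp : ∀ n, StronglyMeasurable[ℱ (n + 1)] (ξ n)) (hL2 : ∀ n, MemLp (ξ n) 2 P)
    (hcond : ∀ n, P[ξ n | ℱ n] =ᵐ[P] 0) {c : ℕ → ℝ} (hc : Summable c)
    (hle : ∀ n, ∫ ω, ξ n ω ^ 2 ∂P ≤ c n) :
    ∀ᵐ ω ∂P, ∃ l, Tendsto (fun n => ∑ k ∈ Finset.range n, ξ k ω) atTop (𝓝 l) := by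
  set f : ℕ → Ω → ℝ := fun n ω => ∑ k ∈ Finset.range n, ξ k ω with hf
  have hfsucc : ∀ n, f (n + 1) = f n + ξ n := fun n => by
    ext ω; simp [hf, Finset.sum_range_succ]
  have hfmeas : ∀ n, StronglyMeasurable[ℱ n] (f n) := by
    intro n
    refine Finset.stronglyMeasurable_fun_sum _ fun k hk => (hadp k).mono (ℱ.mono ?_)
    exact Finset.mem_range.mp hk
  have hfL2 : ∀ n, MemLp (f n) 2 P := fun n => memLp_finsetSum _ fun k _ => hL2 k
  have hfint : ∀ n, Integrable (f n) P := fun n => (hfL2 n).integrable one_le_two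
  have hξint : ∀ n, Integrable (ξ n) P := fun n => (hL2 n).integrable one_le_two
  have hmart : Martingale f ℱ P := by
    refine martingale_of_condExp_sub_eq_zero_nat hfmeas hfint fun n => ?_
    rw [hfsucc n, add_sub_cancel_left]
    exact hcond n
  -- Increments are orthogonal to the past, so second moments add up; |f| ≤ 1 + f² then yields the
  -- L¹ bound for martingale convergence.
  have horth : ∀ n, ∫ ω, f n ω * ξ n ω ∂P = 0 := by
    intro n
    have hprod : Integrable (f n * ξ n) P := (hfL2 n).integrable_mul (hL2 n)
    have h1 := condExp_mul_of_stronglyMeasurable_left (hfmeas n) hprod (hξint n)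
    have h2 : P[f n * ξ n | ℱ n] =ᵐ[P] 0 := by
      filter_upwards [h1, hcond n] with ω h3 h4
      rw [h3, Pi.mul_apply, h4]
      simp
    have h5 := integral_condExp (ℱ.le n) (f := f n * ξ n) (μ := P)
    rw [integral_congr_ae h2] at h5
    simpa using h5.symm
  have hsq : ∀ n, ∫ ω, f n ω ^ 2 ∂P ≤ ∑ k ∈ Finset.range n, c k := by
    intro n
    induction n with
    | zero => simp [hf]
    | succ n ih =>
      have h1 : ∫ ω, f (n + 1) ω ^ 2 ∂P
          = ∫ ω, f n ω ^ 2 ∂P + 2 * ∫ ω, f n ω * ξ n ω ∂P + ∫ ω, ξ n ω ^ 2 ∂P := by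
        have hprod : Integrable (fun ω => f n ω * ξ n ω) P := (hfL2 n).integrable_mul (hL2 n)
        rw [← integral_const_mul, ← integral_add (hfL2 n).integrable_sq (hprod.const_mul 2),
          ← integral_add (f := fun ω => f n ω ^ 2 + 2 * (f n ω * ξ n ω))
            ((hfL2 n).integrable_sq.add (hprod.const_mul 2)) (hL2 n).integrable_sq]
        refine integral_congr_ae (ae_of_all _ fun ω => ?_)
        simp only [hfsucc n, Pi.add_apply]
        ring
      rw [h1, horth n, Finset.sum_range_succ]
      linarith [hle n]
  have hc0 : ∀ n, 0 ≤ c n := fun n => (integral_nonneg fun ω => sq_nonneg _).trans (hle n)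
  refine hmart.submartingale.exists_ae_tendsto_of_bdd (R := (1 + ∑' k, c k).toNNReal) fun n => ?_
  have h1 : ∫ ω, ‖f n ω‖ ∂P ≤ 1 + ∑' k, c k := by
    calc ∫ ω, ‖f n ω‖ ∂P ≤ ∫ ω, (1 + f n ω ^ 2) ∂P := by
          refine integral_mono (hfint n).norm
            ((integrable_const 1).add (hfL2 n).integrable_sq) fun ω => ?_
          simp only [Real.norm_eq_abs]
          nlinarith [sq_nonneg (|f n ω| - 1), sq_abs (f n ω), abs_nonneg (f n ω)]
      _ = 1 + ∫ ω, f n ω ^ 2 ∂P := by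
          rw [integral_add (integrable_const 1) (hfL2 n).integrable_sq]; simp
      _ ≤ 1 + ∑' k, c k := by
          gcongr
          exact (hsq n).trans (hc.sum_le_tsum _ fun k _ => hc0 k)
  rw [eLpNorm_one_eq_lintegral_enorm, ← ofReal_integral_norm_eq_lintegral_enorm (hfint n)]
  exact ENNReal.ofReal_le_ofReal h1

end L2Martingale

/-! ### Measurability with respect to the history. -/

section History

variable {Ω : Type*} {D : ℕ} {d : Fin D → ℕ}
  {τ : Fin D → Fin D → ℕ → Ω → ℕ} {M x : ℕ → Ω → JointState d}

theorem historySigma_mono : Monotone (historySigma τ M x) := by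
  intro n m hnm
  unfold historySigma
  refine sup_le_sup (sup_le_sup le_rfl ?_) ?_
  · exact biSup_mono fun k hk => ⟨hk.1, hk.2.trans hnm⟩
  · refine iSup_mono' fun hn => ⟨hn.trans hnm, ?_⟩
    refine iSup_mono fun i => iSup_mono fun j => biSup_mono fun k hk => ⟨hk.1, hk.2.trans hnm⟩

theorem historySigma_le [mΩ : MeasurableSpace Ω] (hx0 : Measurable (x 0)) (hx1 : Measurable (x 1))
    (hM : ∀ n, 1 ≤ n → Measurable (M (n + 1))) (hτ : ∀ i j n, 1 ≤ n → Measurable (τ i j n))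
    (n : ℕ) : historySigma τ M x n ≤ mΩ := by
  unfold historySigma
  refine sup_le (sup_le (sup_le hx0.comap_le hx1.comap_le) ?_) ?_
  · refine iSup₂_le fun k hk => ?_
    obtain ⟨l, rfl⟩ : ∃ l, k = l + 1 := ⟨k - 1, by have := hk.1; omega⟩
    exact (hM l (by have := hk.1; omega)).comap_le
  · exact iSup_le fun _ => iSup_le fun i => iSup_le fun j => iSup₂_le fun k hk =>
      (hτ i j k hk.1).comap_le

theorem measurable_noise_historySigma {k n : ℕ} (hk : 2 ≤ k) (hkn : k ≤ n) :
    Measurable[historySigma τ M x n] (M k) := by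
  refine measurable_iff_comap_le.mpr ?_
  refine le_trans ?_ le_sup_left
  refine le_trans ?_ le_sup_right
  exact le_iSup₂ (f := fun k (_ : k ∈ Icc 2 n) =>
    MeasurableSpace.comap (M k) inferInstance) k ⟨hk, hkn⟩

/-- The condition 2 ≤ n is essential to the form: the first history σ-algebra is generated by the
initial values alone. -/
theorem measurable_delay_historySigma (i j : Fin D) {k n : ℕ} (hn : 2 ≤ n) (hk : 1 ≤ k)
    (hkn : k ≤ n) : Measurable[historySigma τ M x n] (τ i j k) := by
  refine measurable_iff_comap_le.mpr ?_
  refine le_trans ?_ le_sup_right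
  refine le_trans ?_ (le_iSup _ hn)
  refine le_trans ?_ (le_iSup _ i)
  refine le_trans ?_ (le_iSup _ j)
  exact le_iSup₂ (f := fun k (_ : k ∈ Icc 1 n) =>
    MeasurableSpace.comap (τ i j k) inferInstance) k ⟨hk, hkn⟩

/-- A random index has countably many values; truncating it at n means only the variables up to n
need be measurable. -/
theorem measurable_eval_random_index {Ω F : Type*} [MeasurableSpace Ω] [MeasurableSpace F]
    {z : ℕ → Ω → F} {n : ℕ} (hz : ∀ k ≤ n, Measurable (z k)) {σ : Ω → ℕ} (hσ : Measurable σ)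
    (hσn : ∀ ω, σ ω ≤ n) : Measurable fun ω => z (σ ω) ω := by
  have h1 : Measurable (Function.uncurry fun k ω => z (min k n) ω) :=
    measurable_from_prod_countable_right fun k => hz _ (min_le_right _ _)
  have h2 : (fun ω => z (σ ω) ω) = (Function.uncurry fun k ω => z (min k n) ω) ∘
      fun ω => (σ ω, ω) := by
    funext ω
    simp [min_eq_left (hσn ω)]
  rw [h2]
  exact h1.comp (hσ.prodMk measurable_id)

theorem measurable_jointState {m : MeasurableSpace Ω} {z : Ω → JointState d}
    (hz : ∀ i, Measurable[m] fun ω => z ω i) : Measurable[m] z :=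
  (WithLp.measurable_toLp 2 _).comp (measurable_pi_lambda _ hz)

theorem measurable_agedState {m : MeasurableSpace Ω} {n : ℕ} (hx : ∀ k ≤ n, Measurable[m] (x k))
    (i : Fin D) (hτ : ∀ j, Measurable[m] (τ i j n)) : Measurable[m] (agedState x τ i n) := by
  refine measurable_jointState fun j => ?_
  have h1 := measurable_eval_random_index hx (σ := fun ω => n - τ i j n ω)
    ((measurable_of_countable fun k : ℕ => n - k).comp (hτ j)) (fun ω => Nat.sub_le _ _)
  have h2 : Measurable fun z : JointState d => z j :=
    (measurable_pi_apply j).comp (WithLp.measurable_ofLp 2 _)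
  have h3 : Measurable[m] fun ω => x (n - τ i j n ω) ω j := h2.comp h1
  exact h3

/-- By strong induction, an iterate from time 2 on is a measurable function of earlier iterates, the
preceding delays and the current noise, all contained in the history. -/
theorem IsDistributedSA.measurable_historySigma {h : JointState d → JointState d} {a : ℕ → ℝ}
    (hiter : IsDistributedSA h a τ M x) (hh : Measurable h) {k n : ℕ} (hkn : k ≤ n) :
    Measurable[historySigma τ M x n] (x k) := by
  induction k using Nat.strong_induction_on generalizing n with
  | _ k ih =>
    match k, ih, hkn with
    | 0, _, _ =>
      exact measurable_iff_comap_le.mpr ((le_sup_left.trans le_sup_left).trans le_sup_left)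
    | 1, _, _ =>
      exact measurable_iff_comap_le.mpr ((le_sup_right.trans le_sup_left).trans le_sup_left)
    | k + 2, ih, hkn =>
      have hx : ∀ l ≤ k + 1, Measurable[historySigma τ M x n] (x l) := fun l hl =>
        ih l (by omega) (by omega)
      have hcoord : ∀ i, Measurable[historySigma τ M x n] fun ω => x (k + 2) ω i := by
        intro i
        have hproj : Measurable fun z : JointState d => z i :=
          (measurable_pi_apply i).comp (WithLp.measurable_ofLp 2 _)
        have h1 := measurable_agedState (m := historySigma τ M x n) hx i
          fun j => measurable_delay_historySigma i j (by omega) (by omega) (by omega)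
        have h2 := measurable_noise_historySigma (τ := τ) (x := x) (M := M)
          (show 2 ≤ k + 2 by omega) hkn
        have h3 : (fun ω => x (k + 2) ω i) = fun ω => x (k + 1) ω i +
            a (k + 1) • (h (agedState x τ i (k + 1) ω) i + M (k + 2) ω i) :=
          funext fun ω => hiter (k + 1) (by omega) i ω
        rw [h3]
        have h4 : Measurable[historySigma τ M x n] fun ω => h (agedState x τ i (k + 1) ω) i :=
          hproj.comp (hh.comp h1)
        have h5 : Measurable[historySigma τ M x n] fun ω => M (k + 2) ω i := hproj.comp h2
        have h6 : Measurable[historySigma τ M x n] fun ω => x (k + 1) ω i :=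
          hproj.comp (hx (k + 1) le_rfl)
        exact Measurable.add h6 (Measurable.const_smul (Measurable.add h4 h5) (a (k + 1)))
      exact measurable_jointState hcoord

theorem measurable_runningMax {m : MeasurableSpace Ω} {u : ℕ → Ω → ℝ} {n : ℕ}
    (hu : ∀ k ≤ n, Measurable[m] (u k)) : Measurable[m] fun ω => runningMax (fun k => u k ω) n := by
  induction n with
  | zero => exact measurable_const.max (hu 0 le_rfl)
  | succ n ih => exact (ih fun k hk => hu k (by omega)).max (hu _ le_rfl)

end History

/-! ### Block norms and aged states. -/

section JointState

variable {D : ℕ} {d : Fin D → ℕ}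

theorem JointState.norm_le_of_block_le {z : JointState d} {B : ℝ} (hB : 0 ≤ B)
    (hz : ∀ i, ‖z i‖ ≤ B) : ‖z‖ ≤ √D * B := by
  refine le_of_sq_le_sq ?_ (by positivity)
  rw [PiLp.norm_sq_eq_of_L2, mul_pow, Real.sq_sqrt (Nat.cast_nonneg D)]
  refine (Finset.sum_le_card_nsmul _ _ (B ^ 2) fun i _ => ?_).trans (by simp)
  exact pow_le_pow_left₀ (norm_nonneg _) (hz i) 2

variable {Ω : Type*} {τ : Fin D → Fin D → ℕ → Ω → ℕ} {x : ℕ → Ω → JointState d}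

/-- The blocks may stem from different times, so each is bounded separately by the running maximum;
this costs √D. -/
theorem norm_agedState_le (i : Fin D) (n : ℕ) (ω : Ω) :
    ‖agedState x τ i n ω‖ ≤ √D * runningMax (fun k => ‖x k ω‖) n := by
  refine JointState.norm_le_of_block_le (runningMax_pos n).le fun j => ?_
  have h1 : ‖x (n - τ i j n ω) ω j‖ ≤ ‖x (n - τ i j n ω) ω‖ := PiLp.norm_apply_le _ _
  have h2 : ‖x (n - τ i j n ω) ω‖ ≤ runningMax (fun k => ‖x k ω‖) n :=
    le_runningMax (u := fun k => ‖x k ω‖) (Nat.sub_le n (τ i j n ω))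
  exact h1.trans h2

end JointState

/-! ### Summability of the normalized noise. -/

section Noise

variable {Ω : Type*} [mΩ : MeasurableSpace Ω] {P : Measure Ω} [IsProbabilityMeasure P]
  {D : ℕ} {d : Fin D → ℕ} {τ : Fin D → Fin D → ℕ → Ω → ℕ} {M x : ℕ → Ω → JointState d}

/-- The noise normalized by the running maximum of the iterates has bounded second moments. -/
theorem lintegral_normalized_noise_le {K : ℝ} {n : ℕ} {i : Fin D}
    (hle : historySigma τ M x n ≤ mΩ) (hM : Measurable (M (n + 1)))
    (hx : ∀ k ≤ n, Measurable[historySigma τ M x n] (x k))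
    (hK : ∀ᵐ ω ∂P, P⁻[fun ω' => ENNReal.ofReal (‖M (n + 1) ω' i‖ ^ 2) | historySigma τ M x n] ω ≤
      ENNReal.ofReal (K ^ 2 * (1 + ‖agedState x τ i n ω‖ ^ 2))) :
    ∫⁻ ω, ENNReal.ofReal (((runningMax (fun k => ‖x k ω‖) n)⁻¹ * ‖M (n + 1) ω i‖) ^ 2) ∂P
      ≤ ENNReal.ofReal (K ^ 2 * (1 + D)) := by
  set w : Ω → ℝ := fun ω => (runningMax (fun k => ‖x k ω‖) n)⁻¹ ^ 2 with hw
  have hRm : Measurable[historySigma τ M x n] fun ω => runningMax (fun k => ‖x k ω‖) n :=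
    measurable_runningMax fun k hk => measurable_norm.comp (hx k hk)
  have hwm : Measurable[historySigma τ M x n] fun ω => ENNReal.ofReal (w ω) :=
    ENNReal.measurable_ofReal.comp ((hRm.inv).pow_const 2)
  have hproj : Measurable fun z : JointState d => z i :=
    (measurable_pi_apply i).comp (WithLp.measurable_ofLp 2 _)
  have hXm : Measurable fun ω => ENNReal.ofReal (‖M (n + 1) ω i‖ ^ 2) :=
    ENNReal.measurable_ofReal.comp ((measurable_norm.comp (hproj.comp hM)).pow_const 2)
  calc ∫⁻ ω, ENNReal.ofReal (((runningMax (fun k => ‖x k ω‖) n)⁻¹ * ‖M (n + 1) ω i‖) ^ 2) ∂P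
      = ∫⁻ ω, ENNReal.ofReal (w ω) * ENNReal.ofReal (‖M (n + 1) ω i‖ ^ 2) ∂P := by
        refine lintegral_congr fun ω => ?_
        rw [mul_pow, ENNReal.ofReal_mul (by positivity)]
    _ = ∫⁻ ω, ENNReal.ofReal (w ω) *
          P⁻[fun ω' => ENNReal.ofReal (‖M (n + 1) ω' i‖ ^ 2) | historySigma τ M x n] ω ∂P :=
        (lintegral_mul_condLExp hle P hwm hXm).symm
    _ ≤ ∫⁻ _, ENNReal.ofReal (K ^ 2 * (1 + D)) ∂P := by
        refine lintegral_mono_ae ?_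
        filter_upwards [hK] with ω hω
        refine (mul_le_mul_right hω _).trans ?_
        rw [← ENNReal.ofReal_mul (by positivity)]
        refine ENNReal.ofReal_le_ofReal ?_
        have hR1 := one_le_runningMax (u := fun k => ‖x k ω‖) n
        have hR0 := runningMax_pos (u := fun k => ‖x k ω‖) n
        have h1 := norm_agedState_le (τ := τ) (x := x) i n ω
        set R := runningMax (fun k => ‖x k ω‖) n
        have h2 : ‖agedState x τ i n ω‖ ^ 2 ≤ D * R ^ 2 := by
          calc ‖agedState x τ i n ω‖ ^ 2 ≤ (√D * R) ^ 2 :=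
                pow_le_pow_left₀ (norm_nonneg _) h1 2
            _ = D * R ^ 2 := by rw [mul_pow, Real.sq_sqrt (Nat.cast_nonneg D)]
        -- Since R ≥ 1, the constant in 1 + D * R² is absorbed into (1 + D) * R².
        have h3 : 1 ≤ R ^ 2 := one_le_pow₀ hR1
        have hwR : w ω = (R ^ 2)⁻¹ := by rw [hw]; exact inv_pow _ _
        rw [hwR, inv_mul_le_iff₀ (by positivity)]
        nlinarith [sq_nonneg K]
    _ = ENNReal.ofReal (K ^ 2 * (1 + D)) := by simp

/-- The normalized noise, weighted by square-summable stepsizes, is almost surely summable. -/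
theorem IsMartingaleDifferenceNoise.ae_cauchySeq_normalized
    (hnoise : IsMartingaleDifferenceNoise P τ M x)
    (hle : ∀ n, historySigma τ M x n ≤ mΩ)
    (hx : ∀ k n, k ≤ n → Measurable[historySigma τ M x n] (x k)) {a : ℕ → ℝ}
    (ha : Summable fun n => a (n + 1) ^ 2) :
    ∀ᵐ ω ∂P, CauchySeq fun n => ∑ k ∈ Finset.Ico 1 n,
      (a k * (runningMax (fun k => ‖x k ω‖) k)⁻¹) • M (k + 1) ω := by
  obtain ⟨K, -, hK⟩ := hnoise.secondMoment_le
  -- Index n stands for time n + 1, so the n-th increment carries the noise `M (n + 2)` and is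
  -- adapted at index n + 1.
  set ℱ : Filtration ℕ mΩ := ⟨fun n => historySigma τ M x (n + 1),
    fun n m hnm => historySigma_mono (Nat.succ_le_succ hnm), fun n => hle (n + 1)⟩ with hℱ
  set w : ℕ → Ω → ℝ := fun n ω => a (n + 1) * (runningMax (fun k => ‖x k ω‖) (n + 1))⁻¹ with hw
  have hwm : ∀ n, Measurable[ℱ n] (w n) := fun n =>
    Measurable.const_mul (Measurable.inv (measurable_runningMax fun k hk =>
      measurable_norm.comp (hx k (n + 1) hk))) (a (n + 1))
  have hcoord : ∀ i : Fin D, ∀ c : Fin (d i), ∀ᵐ ω ∂P, ∃ l,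
      Tendsto (fun n => ∑ k ∈ Finset.range n, w k ω * M (k + 2) ω i c) atTop (𝓝 l) := by
    intro i c
    have hproj : Measurable fun z : JointState d => z i c :=
      (measurable_pi_apply c).comp ((WithLp.measurable_ofLp 2 _).comp
        ((measurable_pi_apply i).comp (WithLp.measurable_ofLp 2 _)))
    have hMm : ∀ n, Measurable[ℱ (n + 1)] fun ω => M (n + 2) ω i c := fun n =>
      hproj.comp (measurable_noise_historySigma (by omega) le_rfl)
    have hadp : ∀ n, Measurable[ℱ (n + 1)] fun ω => w n ω * M (n + 2) ω i c := fun n =>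
      Measurable.mul ((hwm n).mono (ℱ.mono n.le_succ) le_rfl) (hMm n)
    have hmeas : ∀ n, Measurable fun ω => w n ω * M (n + 2) ω i c := fun n =>
      (hadp n).mono (ℱ.le _) le_rfl
    have hlint : ∀ n, ∫⁻ ω, ENNReal.ofReal ((w n ω * M (n + 2) ω i c) ^ 2) ∂P
        ≤ ENNReal.ofReal (a (n + 1) ^ 2 * (K ^ 2 * (1 + D))) := by
      intro n
      have h1 := lintegral_normalized_noise_le (hle (n + 1)) (hnoise.measurable (n + 1) (by omega))
        (fun k hk => hx k (n + 1) hk) (hK (n + 1) (by omega) i)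
      rw [ENNReal.ofReal_mul (sq_nonneg _)]
      refine le_trans ?_ (mul_le_mul_right h1 _)
      rw [← lintegral_const_mul' _ _ ENNReal.ofReal_ne_top]
      refine lintegral_mono fun ω => ?_
      rw [← ENNReal.ofReal_mul (sq_nonneg _)]
      refine ENNReal.ofReal_le_ofReal ?_
      have h2 : |M (n + 2) ω i c| ≤ ‖M (n + 2) ω i‖ := PiLp.norm_apply_le (M (n + 2) ω i) c
      have h3 : (M (n + 2) ω i c) ^ 2 ≤ ‖M (n + 2) ω i‖ ^ 2 := by
        rw [← sq_abs]; exact pow_le_pow_left₀ (abs_nonneg _) h2 2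
      simp only [hw, mul_pow]
      rw [mul_assoc]
      gcongr
    have hsqint : ∀ n, Integrable (fun ω => (w n ω * M (n + 2) ω i c) ^ 2) P := by
      intro n
      refine (lintegral_ofReal_ne_top_iff_integrable ((hmeas n).pow_const 2).aestronglyMeasurable
        (ae_of_all _ fun ω => sq_nonneg _)).mp ?_
      exact ne_top_of_le_ne_top ENNReal.ofReal_ne_top (hlint n)
    have hL2 : ∀ n, MemLp (fun ω => w n ω * M (n + 2) ω i c) 2 P := fun n =>
      (memLp_two_iff_integrable_sq (hmeas n).aestronglyMeasurable).mpr (hsqint n)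
    refine ae_exists_tendsto_sum_of_condExp_eq_zero (ℱ := ℱ)
      (ξ := fun n ω => w n ω * M (n + 2) ω i c) (fun n => (hadp n).stronglyMeasurable) hL2 ?_
      (ha.mul_right (K ^ 2 * (1 + D))) ?_
    · intro n
      have hint := hnoise.integrable (n + 1) (by omega) i
      have h1 : P[(fun ω => M (n + 2) ω i c) | ℱ n] =ᵐ[P] 0 := by
        have h2 := ContinuousLinearMap.comp_condExp_comm (m := historySigma τ M x (n + 1)) hint
          (EuclideanSpace.proj c : EuclideanSpace ℝ (Fin (d i)) →L[ℝ] ℝ)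
        refine h2.symm.trans ?_
        filter_upwards [hnoise.condExp_eq_zero (n + 1) (by omega) i] with ω hω
        simp only [Function.comp_apply, hω, Pi.zero_apply, map_zero]
      have hintc : Integrable (fun ω => M (n + 2) ω i c) P :=
        (EuclideanSpace.proj c : EuclideanSpace ℝ (Fin (d i)) →L[ℝ] ℝ).integrable_comp hint
      have h3 := condExp_mul_of_stronglyMeasurable_left (μ := P) (m := ℱ n)
        (f := w n) (g := fun ω => M (n + 2) ω i c) (hwm n).stronglyMeasurable
        ((hL2 n).integrable one_le_two) hintc
      refine h3.trans ?_
      filter_upwards [h1] with ω hω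
      simp [hω]
    · intro n
      rw [integral_eq_lintegral_of_nonneg_ae (ae_of_all _ fun ω => sq_nonneg _)
        ((hmeas n).pow_const 2).aestronglyMeasurable]
      exact ENNReal.toReal_le_of_le_ofReal (by positivity) (hlint n)
  filter_upwards [ae_all_iff.mpr fun i => ae_all_iff.mpr (hcoord i)] with ω hω
  choose l hl using hω
  have htend : Tendsto (fun n => ∑ k ∈ Finset.range n, w k ω • M (k + 2) ω) atTop
      (𝓝 (WithLp.toLp 2 fun i => WithLp.toLp 2 fun c => l i c : JointState d)) := by
    have h1 : ∀ n, ∑ k ∈ Finset.range n, w k ω • M (k + 2) ω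
        = (WithLp.toLp 2 fun i => WithLp.toLp 2 fun c =>
          ∑ k ∈ Finset.range n, w k ω * M (k + 2) ω i c : JointState d) := by
      intro n
      ext i c
      simp [WithLp.ofLp_sum, Finset.sum_apply]
    simp only [h1]
    refine ((PiLp.continuous_toLp 2 _).tendsto _).comp (tendsto_pi_nhds.mpr fun i => ?_)
    exact ((PiLp.continuous_toLp 2 _).tendsto _).comp (tendsto_pi_nhds.mpr fun c => hl i c)
  refine Tendsto.cauchySeq ((tendsto_add_atTop_iff_nat 1).mp (htend.congr fun n => ?_))
  rw [Finset.sum_Ico_eq_sum_range]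
  refine Finset.sum_congr (by simp) fun k _ => ?_
  simp only [hw, add_comm 1 k]

end Noise

/-! ### Boundedness along a single path. -/

section Pathwise

variable {Ω : Type*} {D : ℕ} {d : Fin D → ℕ} {τ : Fin D → Fin D → ℕ → Ω → ℕ}
  {M x : ℕ → Ω → JointState d} {h : JointState d → JointState d} {a : ℕ → ℝ}

theorem norm_apply_agedState_le {L : ℝ≥0} (hL : LipschitzWith L h) (i : Fin D) (n : ℕ) (ω : Ω) :
    ‖h (agedState x τ i n ω) i‖ ≤ (‖h 0‖ + L * √D) * runningMax (fun k => ‖x k ω‖) n := by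
  have h1 : ‖h (agedState x τ i n ω) i‖ ≤ ‖h (agedState x τ i n ω)‖ := PiLp.norm_apply_le _ _
  have h2 := hL.dist_le_mul (agedState x τ i n ω) 0
  rw [dist_eq_norm, dist_zero_right] at h2
  have h3 := norm_sub_norm_le (h (agedState x τ i n ω)) (h 0)
  have h4 := mul_le_mul_of_nonneg_left (norm_agedState_le (τ := τ) (x := x) i n ω) L.2
  have h5 := mul_le_mul_of_nonneg_left (one_le_runningMax (u := fun k => ‖x k ω‖) n)
    (norm_nonneg (h 0))
  change (L : ℝ) * _ ≤ (L : ℝ) * _ at h4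
  linarith

theorem norm_agedState_sub_le {i : Fin D} {n : ℕ} {ω : Ω} {B : ℝ} (hB : 0 ≤ B)
    (hx : ∀ j, ‖x n ω - x (n - τ i j n ω) ω‖ ≤ B) : ‖agedState x τ i n ω - x n ω‖ ≤ √D * B := by
  refine JointState.norm_le_of_block_le hB fun j => ?_
  have h1 : ‖(x n ω - x (n - τ i j n ω) ω) j‖ ≤ ‖x n ω - x (n - τ i j n ω) ω‖ :=
    PiLp.norm_apply_le _ _
  have h2 : (agedState x τ i n ω - x n ω) j = -(x n ω - x (n - τ i j n ω) ω) j := by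
    simp [agedState]
  rw [h2, norm_neg]
  exact h1.trans (hx j)

/-- Along every path on which the delays span a vanishing amount of ODE time and the normalized
noise is summable, the iterates of the distributed scheme are bounded. -/
theorem IsDistributedSA.bddAbove_norm (hiter : IsDistributedSA h a τ M x) {L : ℝ≥0}
    (hL : LipschitzWith L h) (hscale : HasStableScalingLimit h) (ha0 : ∀ n, 1 ≤ n → 0 ≤ a n)
    (ha : Tendsto a atTop (𝓝 0))
    (hsum : Tendsto (fun m => ∑ k ∈ Finset.Ico 1 m, a k) atTop atTop) {ω : Ω}
    (hlag : ∀ i j, ∀ ε : ℝ, 0 < ε → ∀ᶠ n in atTop,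
      n ≤ 2 * (n - τ i j n ω) ∧ ∑ k ∈ Finset.Ico (n - τ i j n ω) n, a k ≤ ε)
    (hnoise : CauchySeq fun n => ∑ k ∈ Finset.Ico 1 n,
      (a k * (runningMax (fun k => ‖x k ω‖) k)⁻¹) • M (k + 1) ω) :
    BddAbove (Set.range fun n => ‖x n ω‖) := by
  set C : ℝ := √D * (‖h 0‖ + L * √D) with hC
  -- Each agent evaluates h at its own aged state, so g is assembled block by block and is not h of
  -- a single point.
  set g : ℕ → JointState d := fun n => WithLp.toLp 2 fun i => h (agedState x τ i n ω) i with hg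
  have hsch : IsNormalizedScheme (fun n => x n ω) g (fun n => ∑ k ∈ Finset.Ico 1 n,
      (a k * (runningMax (fun k => ‖x k ω‖) k)⁻¹) • M (k + 1) ω) a C := by
    refine ⟨fun n hn => ?_, ha0, by positivity, fun n _ => ?_, hnoise⟩
    · have hR := (runningMax_pos (u := fun k => ‖x k ω‖) n).ne'
      rw [Finset.sum_Ico_succ_top hn, add_sub_cancel_left, smul_smul, mul_comm (a n),
        mul_inv_cancel_left₀ hR, add_assoc, ← smul_add]
      ext i : 1
      exact hiter n hn i ω
    · have h1 : ∀ i, ‖g n i‖ ≤ (‖h 0‖ + L * √D) * runningMax (fun k => ‖x k ω‖) n :=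
        fun i => norm_apply_agedState_le hL i n ω
      have hR := (runningMax_pos (u := fun k => ‖x k ω‖) n).le
      refine (JointState.norm_le_of_block_le (by positivity) h1).trans (le_of_eq ?_)
      rw [hC, mul_assoc]
  refine hsch.bddAbove_norm hL hscale ha hsum fun ε hε => ?_
  have hC0 : 0 ≤ C := hsch.const_nonneg
  -- η is the common tolerance for lag time and noise: a delay window moves the iterate by at most
  -- (C + 2) * η * R, and the block and Lipschitz factors turn this into ε * R.
  set η : ℝ := ε / ((C + 2) * (L * D + 1)) with hη
  have hη0 : 0 < η := by positivity
  obtain ⟨n₀, hn₀⟩ := eventually_atTop.mp (hsch.eventually_noise_le hη0)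
  -- Together with n ≤ 2 * (n - τ), this puts the start of every delay window beyond n₀.
  filter_upwards [eventually_ge_atTop (2 * (n₀ + 1)),
    eventually_all.mpr fun i => eventually_all.mpr fun j => hlag i j η hη0] with n hn hlagn
  set R := runningMax (fun k => ‖x k ω‖) n with hR
  have hR0 : 0 < R := runningMax_pos n
  have hdiff : ∀ i j, ‖x n ω - x (n - τ i j n ω) ω‖ ≤ (C + 2) * η * R := by
    intro i j
    obtain ⟨h1, h2⟩ := hlagn i j
    have h3 := hsch.norm_iterate_sub_le_mul_runningMax (n := n - τ i j n ω) (m := n) (by omega)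
      (Nat.sub_le _ _) (hn₀ (n - τ i j n ω) (by omega))
    refine h3.trans (mul_le_mul_of_nonneg_right ?_ hR0.le)
    have h4 := mul_le_mul_of_nonneg_left h2 hC0
    linarith
  have hblock : ∀ i, ‖(g n - h (x n ω)) i‖ ≤ L * (√D * ((C + 2) * η * R)) := by
    intro i
    have h1 : ‖(h (agedState x τ i n ω) - h (x n ω)) i‖
        ≤ ‖h (agedState x τ i n ω) - h (x n ω)‖ := PiLp.norm_apply_le _ _
    have h2 := hL.dist_le_mul (agedState x τ i n ω) (x n ω)
    rw [dist_eq_norm, dist_eq_norm] at h2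
    have h3 := norm_agedState_sub_le (τ := τ) (i := i) (by positivity) (hdiff i)
    exact (h1.trans h2).trans (mul_le_mul_of_nonneg_left h3 L.2)
  refine (JointState.norm_le_of_block_le (by positivity) hblock).trans ?_
  have hD : √(D : ℝ) * √D = D := Real.mul_self_sqrt (Nat.cast_nonneg D)
  calc √(D : ℝ) * (L * (√D * ((C + 2) * η * R)))
      = (√D * √D) * L * ((C + 2) * η) * R := by ring
    _ = (L * D) * ((C + 2) * η) * R := by rw [hD]; ring
    _ ≤ (L * D + 1) * ((C + 2) * η) * R := by gcongr; linarith
    _ = ε * R := by rw [hη]; field_simp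

end Pathwise

/-! ### Assembly of the main theorem. -/

theorem IsAoIP.measurable {Ω : Type*} [MeasurableSpace Ω] {τ : ℕ → Ω → ℕ} (hτ : IsAoIP τ) {n : ℕ}
    (hn : 1 ≤ n) : Measurable (τ n) := by
  obtain ⟨m, hm, h⟩ := hτ
  have h1 : τ n = (fun k : ℕ => n - k) ∘ m n := funext fun ω => (h n hn ω).2.2
  rw [h1]
  exact (measurable_of_countable _).comp (hm n hn)

theorem theorem1
    {Ω : Type*} [MeasurableSpace Ω] (P : Measure Ω) [IsProbabilityMeasure P]
    {Ω' : Type*} [MeasurableSpace Ω'] (P' : Measure Ω') [IsProbabilityMeasure P']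
    {D : ℕ} (d : Fin D → ℕ)
    (h : JointState d → JointState d) (a : ℕ → ℝ)
    (τ : Fin D → Fin D → ℕ → Ω → ℕ) (M x : ℕ → Ω → JointState d)
    -- the iteration and its initial values
    (hx0_meas : Measurable (x 0)) (hx1_meas : Measurable (x 1))
    (hx0 : MemLp (x 0) 2 P) (hx1 : MemLp (x 1) 2 P)
    (hiter : IsDistributedSA h a τ M x)
    -- Lipschitz drift
    (L : ℝ≥0) (hLip : LipschitzWith L h)
    -- scaling limit
    (hscale : HasStableScalingLimit h)
    -- noise
    (hnoise : IsMartingaleDifferenceNoise P τ M x)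
    -- delays
    (haoi : ∀ i j, IsAoIP (τ i j))
    (p : ℝ) (hp : 0 < p) (τbar : Ω' → ℝ)
    (hτbar_meas : Measurable τbar) (hτbar_nonneg : ∀ᵐ ω ∂P', 0 ≤ τbar ω)
    (hdom : ∀ i j n, 1 ≤ n → StochDominatedBy P P' (fun ω => (τ i j n ω : ℝ)) τbar)
    (hmoment : Integrable (fun ω => τbar ω ^ p) P')
    -- stepsize
    (hstep : IsStepsizeFor p a) :
    ∀ᵐ ω ∂P, BddAbove (Set.range (fun n => ‖x n ω‖)) := by
  obtain ⟨α, β, hα, hβ, hβ1, hβp, ha⟩ := hstep.exists_power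
  have hβ0 : 0 < β := by linarith
  have hle : ∀ n, historySigma τ M x n ≤ ‹MeasurableSpace Ω› := fun n =>
    historySigma_le hx0_meas hx1_meas hnoise.measurable (fun i j n hn => (haoi i j).measurable hn) n
  have hdelay : ∀ᵐ ω ∂P, ∀ i j,
      Tendsto (fun n => (τ i j n ω : ℝ) / (n : ℝ) ^ β) atTop (𝓝 0) :=
    ae_all_iff.mpr fun i => ae_all_iff.mpr fun j =>
      (haoi i j).ae_tendsto_div_rpow (hdom i j) hτbar_nonneg hp hmoment hβp
  have hnorm := hnoise.ae_cauchySeq_normalized hle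
    (fun k n hkn => hiter.measurable_historySigma hLip.continuous.measurable hkn)
    (summable_sq_powerStepsize hβ ha)
  filter_upwards [hdelay, hnorm] with ω hω1 hω2
  exact hiter.bddAbove_norm hLip hscale
    (fun n hn => by rw [ha n hn]; positivity) (tendsto_powerStepsize hβ0 ha)
    (tendsto_sum_powerStepsize hα hβ1 ha)
    (fun i j ε hε => eventually_sum_lag_le hα hβ0 hβ1 ha (hω1 i j) hε) hω2
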